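/- Let $n\ge 1$ and let $\Omega\subset\mathbb R^n$ be a bounded open set whose boundary $\Gamma:=\overline\Omega\setminus\Omega$ is a hypersurface (that is, a Lipschitz $(n-1)$-submanifold: every point of $\Gamma$ has a neighbourhood in $\Gamma$ which is bi-Lipschitz homeomorphic to an open subset of $\mathbb R^{n-1}$; every embedded $C^1$ hypersurface is of this kind). Let $\delta>0$ and let $m_\delta:\mathbb R^n\to\mathbb C$ vanish outside $\overline\Omega$, be smooth in $\Omega$, and satisfy, for every multi-index $\alpha$, $|\partial^\alpha m_\delta(\xi)|\lesssim d(\xi,\Gamma)^{\delta-|\alpha|}$ for $\xi\in\Omega$. Let $O_i=B(c_i,r_i)$ be a family of balls whose union is $\Omega$, with bounded overlap and with $r_i$ comparable to $d(O_i,\Gamma)$ uniformly in $i$, and let $(\chi_i)$ be real-valued functions, smooth on $\mathbb R^n$, with $\chi_i=0$ outside $O_i$, $\sum_i\chi_i=\mathbf 1_\Omega$ and $\|\partial^\alpha\chi_i\|_\infty\lesssim r_i^{-|\alpha|}$ uniformly in $i$ for every $\alpha$. For $j\in\mathbb Z$ and $f\in L^1(\mathbb R^n)$ put $$U_j f(x):=\sum_{l:\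 2^j\le r_l<2^{j+1}}\int_\Omega e^{ix\cdot\xi}\,\widehat f(\xi)\,\bigl(2^{-j\delta}m_\delta(\xi)\bigr)\chi_l(\xi)\,d\xi,\qquad \widehat f(\xi)=(2\pi)^{-n}\int e^{-iy\cdot\xi}f(y)\,dy .$$ Then there are kernels $K_j\in L^1(\mathbb R^n)$, $j\in\mathbb Z$, such that $U_jf(x)=K_j*f(x)$ for all $f\in L^1$ and all $x$; convolution with $K_j$ is used to define $U_j$ on other functions. These satisfy the following, with constants that do not depend on $j$ (for large $j$ the operator $U_j$ is $0$, so that only $j\lesssim 0$ matters). 1. $\|K_j\|_{L^1}\le C\,2^{-j(n-1)/2}$, and, for every $p\in[1,\infty]$, $U_j$ is bounded on $L^p$ with $\|U_j\|_{L^p\to L^p}\le C\,2^{-j(n-1)/2}$. 2. For every $s\in[1,2]$ there is a constant $C$ such that, for all $j$, all measurable $f$ and all $x$, $|K_j*f(x)|\le C\,2^{-j(n-1)/s}\,\mathcal M_sf(x)$, where $\mathcal M_sf=\bigl(\mathcal M(|f|^s)\bigr)^{1/s}$ and $\mathcal M$ is the uncentred Hardy–Littlewood maximal function over balls (the bound is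 understood to be void where $\mathcal M_sf(x)=\infty$). 3. For every $s\in[1,2]$, every $p\in(s,\infty)$ and every weight $\omega$ in the Muckenhoupt class $\mathbb A_{p/s}$ there is a constant $C$ such that, for all $j$, $U_j$ is bounded on $L^p(\omega)$ with $\|U_j\|_{L^p(\omega)\to L^p(\omega)}\le C\,2^{-j(n-1)/s}$. -/

import Mathlib

open MeasureTheory Metric
open scoped ENNReal NNReal ContDiff

noncomputable section

/-- `Γ ⊆ ℝⁿ` is a (Lipschitz, embedded) hypersurface: around each of its points it is the
bi-Lipschitz image of an open subset of `ℝⁿ⁻¹`. Every embedded hypersurface of class `C¹`, and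
every boundary which is locally a Lipschitz graph, is of this kind. -/
def IsLipschitzHypersurface {n : ℕ} (Γ : Set (EuclideanSpace ℝ (Fin n))) : Prop :=
  ∀ x ∈ Γ, ∃ (U : Set (EuclideanSpace ℝ (Fin n))) (V : Set (EuclideanSpace ℝ (Fin (n - 1))))
    (φ : EuclideanSpace ℝ (Fin (n - 1)) → EuclideanSpace ℝ (Fin n)) (L : ℝ),
    IsOpen U ∧ x ∈ U ∧ IsOpen V ∧ φ '' V = Γ ∩ U ∧
    ∀ a ∈ V, ∀ b ∈ V, dist (φ a) (φ b) ≤ L * dist a b ∧ dist a b ≤ L * dist (φ a) (φ b)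

/-- `m` is a generalized Bochner–Riesz symbol of order `δ` on `Ω`, where `Γ = closure Ω \ Ω`:
it vanishes off the closure of `Ω`, is smooth in `Ω`, and
`|∂^α m(ξ)| ≲ d(ξ, Γ) ^ (δ - |α|)` in `Ω` for each `α`. -/
structure IsBochnerRieszSymbol {n : ℕ} (Ω : Set (EuclideanSpace ℝ (Fin n))) (δ : ℝ)
    (m : EuclideanSpace ℝ (Fin n) → ℂ) : Prop where
  support_subset : Function.support m ⊆ closure Ω
  contDiffOn : ContDiffOn ℝ ∞ m Ω
  deriv_bound : ∀ k : ℕ, ∃ C : ℝ, ∀ ξ ∈ Ω,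
    ‖iteratedFDeriv ℝ k m ξ‖ ≤ C * infDist ξ (closure Ω \ Ω) ^ (δ - (k : ℝ))

/-- The distance `inf {|x - y| : x ∈ S, y ∈ T}` between two sets. -/
def setDist {n : ℕ} (S T : Set (EuclideanSpace ℝ (Fin n))) : ℝ :=
  sInf (Set.image2 dist S T)

/-- The balls `O i = B(c i, r i)` form a Whitney covering of `Ω`: they are contained in `Ω` and
cover it, they have bounded overlap, and `r i` is comparable to `d(O i, Γ)`,
`Γ = closure Ω \ Ω`. -/
structure IsWhitneyCovering {n : ℕ} {ι : Type*} (Ω : Set (EuclideanSpace ℝ (Fin n)))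
    (c : ι → EuclideanSpace ℝ (Fin n)) (r : ι → ℝ) : Prop where
  radius_pos : ∀ i, 0 < r i
  iUnion_eq : ⋃ i, ball (c i) (r i) = Ω
  bounded_overlap : ∃ N : ℕ, ∀ ξ, {i | ξ ∈ ball (c i) (r i)}.encard ≤ N
  radius_equiv : ∃ A : ℝ, 0 < A ∧ ∀ i,
    A⁻¹ * setDist (ball (c i) (r i)) (closure Ω \ Ω) ≤ r i ∧
    r i ≤ A * setDist (ball (c i) (r i)) (closure Ω \ Ω)

/-- The functions `χ i` form a smooth partition of unity of `Ω` adapted to the balls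
`B(c i, r i)`, with `‖∂^α χ i‖_∞ ≲ (r i) ^ (-|α|)` uniformly in `i`, for each `α`. -/
structure IsAdaptedPartition {n : ℕ} {ι : Type*} (Ω : Set (EuclideanSpace ℝ (Fin n)))
    (c : ι → EuclideanSpace ℝ (Fin n)) (r : ι → ℝ)
    (χ : ι → EuclideanSpace ℝ (Fin n) → ℝ) : Prop where
  contDiff : ∀ i, ContDiff ℝ ∞ (χ i)
  support_subset : ∀ i, Function.support (χ i) ⊆ ball (c i) (r i)
  sum_eq : ∀ ξ, ∑ᶠ i, χ i ξ = Ω.indicator (fun _ => (1 : ℝ)) ξ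
  deriv_bound : ∀ k : ℕ, ∃ C : ℝ, ∀ i ξ, ‖iteratedFDeriv ℝ k (χ i) ξ‖ ≤ C / r i ^ k

/-- The Fourier transform `f̂(ξ) = (2π)^{-n} ∫ e^{-i y·ξ} f(y) dy`, normalized so that the
inversion formula is `f(x) = ∫ e^{i x·ξ} f̂(ξ) dξ`. -/
def angularFourier {n : ℕ} (f : EuclideanSpace ℝ (Fin n) → ℂ) (ξ : EuclideanSpace ℝ (Fin n)) : ℂ :=
  ((2 * Real.pi : ℝ) : ℂ)⁻¹ ^ n *
    ∫ y, Complex.exp (-(Complex.I * ((inner ℝ y ξ : ℝ) : ℂ))) * f y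

/-- The piece of scale `2 ^ j` of the multiplier, on integrable functions `f`:
`U_j f(x) = ∑_{l : 2^j ≤ r l < 2^{j+1}} ∫_Ω e^{i x·ξ} f̂(ξ) (2^{-jδ} m(ξ)) χ_l(ξ) dξ`
(a finite sum when the balls form a Whitney covering of a bounded set). -/
def whitneyPiece {n : ℕ} {ι : Type*} (Ω : Set (EuclideanSpace ℝ (Fin n))) (δ : ℝ)
    (m : EuclideanSpace ℝ (Fin n) → ℂ) (r : ι → ℝ) (χ : ι → EuclideanSpace ℝ (Fin n) → ℝ)
    (j : ℤ) (f : EuclideanSpace ℝ (Fin n) → ℂ) (x : EuclideanSpace ℝ (Fin n)) : ℂ :=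
  ∑ᶠ l ∈ {l : ι | (2 : ℝ) ^ j ≤ r l ∧ r l < (2 : ℝ) ^ (j + 1)},
    ∫ ξ in Ω, Complex.exp (Complex.I * ((inner ℝ x ξ : ℝ) : ℂ)) * angularFourier f ξ *
      ((((2 : ℝ) ^ (-((j : ℝ) * δ)) : ℝ) : ℂ) * m ξ) * ((χ l ξ : ℝ) : ℂ)

/-- The maximal function `M_s f = (M(|f|^s))^{1/s}`, with `M` the uncentred Hardy–Littlewood
maximal function over balls. -/
def maximalFunction {n : ℕ} (s : ℝ) (f : EuclideanSpace ℝ (Fin n) → ℂ)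
    (x : EuclideanSpace ℝ (Fin n)) : ℝ≥0∞ :=
  (⨆ (z : EuclideanSpace ℝ (Fin n)) (ρ : ℝ) (_ : x ∈ ball z ρ),
    ⨍⁻ y in ball z ρ, ‖f y‖ₑ ^ s ∂volume) ^ (1 / s)

/-- Muckenhoupt's class `A_q`, `1 < q < ∞`, with `q' = q / (q - 1)`. The averages are taken in
`[0, ∞]`, so that `w ^ (1 - q')` is `∞` where `w = 0`. -/
structure IsMuckenhouptWeight {n : ℕ} (q : ℝ) (w : EuclideanSpace ℝ (Fin n) → ℝ) : Prop where
  nonneg : ∀ x, 0 ≤ w x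
  locallyIntegrable : LocallyIntegrable w volume
  bound : ∃ C : ℝ≥0, ∀ (z : EuclideanSpace ℝ (Fin n)) (ρ : ℝ), 0 < ρ →
    (⨍⁻ y in ball z ρ, ENNReal.ofReal (w y) ∂volume) *
      (⨍⁻ y in ball z ρ, ENNReal.ofReal (w y) ^ (1 - q / (q - 1)) ∂volume) ^ (q - 1) ≤ C

/-- The convolution `K ∗ f`. -/
def conv {n : ℕ} (K f : EuclideanSpace ℝ (Fin n) → ℂ) : EuclideanSpace ℝ (Fin n) → ℂ :=
  convolution K f (ContinuousLinearMap.mul ℂ ℂ) volume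

/-- Convolution with `K` is a bounded operator on `L^p(μ)`, of norm at most `B`: for each
`f ∈ L^p(μ)` the integral defining `K ∗ f` converges absolutely `μ`-almost everywhere, and
`K ∗ f ∈ L^p(μ)` with `‖K ∗ f‖ ≤ B ‖f‖`. -/
def ConvBoundedOn {n : ℕ} (K : EuclideanSpace ℝ (Fin n) → ℂ) (p : ℝ≥0∞)
    (μ : Measure (EuclideanSpace ℝ (Fin n))) (B : ℝ) : Prop :=
  ∀ f : EuclideanSpace ℝ (Fin n) → ℂ, MemLp f p μ →
    (∀ᵐ x ∂μ, ConvolutionExistsAt K f x (ContinuousLinearMap.mul ℂ ℂ) volume) ∧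
    MemLp (conv K f) p μ ∧ eLpNorm (conv K f) p μ ≤ ENNReal.ofReal B * eLpNorm f p μ

end

/-! Put t = 2^j. The symbol of U_j is a sum ψ of bumps t^(-δ) m χ_l over balls of radius about t, at
distance about t from Γ. There the bounds for m cancel the factor t^(-δ): ψ is bounded and each
derivative costs t⁻¹, uniformly by bounded overlap. The geometry of Γ enters once: an
(n-1)-dimensional Γ leaves room for only O(t^(-(n-1))) such balls, so the support of ψ has measure
O(t) (`IsWhitneyCovering.exists_card_mul_pow_le`, `exists_sum_localSymbol_bounds`).

Let K be the kernel of ψ and W(y) = (1 + t|y|)^(n+1). Differentiating ψ up to n+1 times pays for W,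
so ‖K W‖_∞ ≲ t by the size of the support and ‖K W‖_2 ≲ t^(1/2) by Plancherel
(`exists_angularKernel_bounds`). Hence ‖K W‖_{s'} ≲ t^(1/s) whenever s' ≥ 2, which is the range s ≤
2. The L^s norm of W⁻¹ f(x - ·) is at most a multiple of t^(-n/s) M_s f(x), since W⁻¹ is radially
decreasing and integrable. Hölder gives ∫ |K(y)| |f(x - y)| dy ≲ t^(-(n-1)/s) M_s f(x)
(`exists_lintegral_kernel_le`), which is claim 2.

Claim 1 is the case s = 2, f = 1, followed by Young's inequality. Claim 3 follows from claim 2 and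
Muckenhoupt's theorem on L^{p/s}(ω). The latter is proved by Lerner's argument: A_q makes w and its
dual weight doubling, and the maximal function is dominated by a composition of the two weighted
ones, each bounded by Vitali covering and the layer-cake formula. -/

/-! ### Packing and counting near a hypersurface -/

/-- Volume packing: balls of radius `t` with overlap at most `N` and centres in a ball of
radius `R` are at most `N ((R + t) / t) ^ d` in number. -/
theorem card_mul_pow_le_of_overlap {d : ℕ} {α : Type*} (I : Finset α)
    (g : α → EuclideanSpace ℝ (Fin d)) {t R : ℝ} (ht : 0 < t) (hR : 0 ≤ R)
    (a : EuclideanSpace ℝ (Fin d)) (N : ℕ)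
    (hov : ∀ y, ∀ J ⊆ I, (∀ l ∈ J, dist (g l) y < t) → J.card ≤ N)
    (hin : ∀ l ∈ I, dist (g l) a ≤ R) :
    (I.card : ℝ) * t ^ d ≤ N * (R + t) ^ d := by
  classical
  -- The indicators of the balls add up to at most N at each point, and to 0 outside the ball of
  -- radius R + t.
  have key : ∑ l ∈ I, volume (ball (g l) t) ≤ N * volume (ball a (R + t)) := by
    calc ∑ l ∈ I, volume (ball (g l) t)
        = ∑ l ∈ I, ∫⁻ y, (ball (g l) t).indicator 1 y := by
          refine Finset.sum_congr rfl fun l _ => ?_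
          rw [lintegral_indicator_one measurableSet_ball]
      _ = ∫⁻ y, ∑ l ∈ I, (ball (g l) t).indicator 1 y := by
          rw [lintegral_finsetSum]
          exact fun l _ => (measurable_one.indicator measurableSet_ball)
      _ ≤ ∫⁻ y, (ball a (R + t)).indicator (fun _ => (N : ℝ≥0∞)) y := by
          refine lintegral_mono fun y => ?_
          have h1 : ∑ l ∈ I, (ball (g l) t).indicator (1 : EuclideanSpace ℝ (Fin d) → ℝ≥0∞) y =
              ((I.filter fun l => dist (g l) y < t).card : ℝ≥0∞) := by
            rw [Finset.card_filter]
            push_cast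
            refine Finset.sum_congr rfl fun l _ => ?_
            simp [Set.indicator_apply, dist_comm]
          rw [h1]
          by_cases hy : y ∈ ball a (R + t)
          · rw [Set.indicator_of_mem hy]
            exact Nat.cast_le.2 (hov y _ (Finset.filter_subset _ _) fun l hl => (Finset.mem_filter.1 hl).2)
          · rw [Set.indicator_of_notMem hy, Finset.filter_false_of_mem]
            · simp
            · intro l hl h
              apply hy
              rw [mem_ball]
              have := hin l hl
              have := dist_triangle_left y a (g l)
              linarith
      _ = N * volume (ball a (R + t)) := by
          rw [lintegral_indicator measurableSet_ball, lintegral_const,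
            Measure.restrict_apply_univ]
  have hB : ∀ (x : EuclideanSpace ℝ (Fin d)) (s : ℝ), 0 < s →
      volume (ball x s) = ENNReal.ofReal (s ^ d) * volume (ball (0 : EuclideanSpace ℝ (Fin d)) 1) := by
    intro x s hs
    rw [Measure.addHaar_ball_of_pos _ _ hs]
    simp
  simp_rw [hB _ _ ht, hB _ _ (by linarith : 0 < R + t)] at key
  rw [Finset.sum_const, nsmul_eq_mul, ← mul_assoc, ← mul_assoc] at key
  have h0 : volume (ball (0 : EuclideanSpace ℝ (Fin d)) 1) ≠ 0 := (measure_ball_pos _ _ one_pos).ne'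
  have h1 : volume (ball (0 : EuclideanSpace ℝ (Fin d)) 1) ≠ ⊤ := measure_ball_lt_top.ne
  rw [ENNReal.mul_le_mul_iff_left h0 h1] at key
  have := ENNReal.toReal_mono (by finiteness) key
  simpa [ENNReal.toReal_mul, ENNReal.toReal_ofReal, ht.le, (by linarith : 0 ≤ R + t), pow_nonneg]
    using this

/-- A bi-Lipschitz chart carries the points to ℝ^(n-1), where volume packing applies in dimension
n-1; compactness of Γ leaves finitely many charts. The overlap is controlled at every dilation ρ
because a chart distorts distances by a constant known only later. -/
theorem IsLipschitzHypersurface.card_mul_pow_le {n : ℕ} {Γ : Set (EuclideanSpace ℝ (Fin n))}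
    (hΓ : IsLipschitzHypersurface Γ) (hc : IsCompact Γ) (T : ℝ) (N : ℝ → ℕ) (ι : Type*) :
    ∃ C : ℝ, ∀ t : ℝ, 0 < t → t ≤ T → ∀ (I : Finset ι) (g : ι → EuclideanSpace ℝ (Fin n)),
      (∀ l ∈ I, g l ∈ Γ) →
      (∀ ρ : ℝ, 0 < ρ → ∀ y, ∀ J ⊆ I, (∀ l ∈ J, dist (g l) y < ρ * t) → J.card ≤ N ρ) →
      (I.card : ℝ) * t ^ (n - 1) ≤ C := by
  classical
  -- Compactness induction runs over subsets S of Γ with points in Γ ∩ S; the redundant intersection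
  -- is the case S = Γ.
  suffices h : ∃ C : ℝ, ∀ t : ℝ, 0 < t → t ≤ T → ∀ (I : Finset ι)
      (g : ι → EuclideanSpace ℝ (Fin n)), (∀ l ∈ I, g l ∈ Γ ∩ Γ) →
      (∀ ρ : ℝ, 0 < ρ → ∀ y, ∀ J ⊆ I, (∀ l ∈ J, dist (g l) y < ρ * t) → J.card ≤ N ρ) →
      (I.card : ℝ) * t ^ (n - 1) ≤ C by simpa using h
  refine hc.induction_on (p := fun S => ∃ C : ℝ, ∀ t : ℝ, 0 < t → t ≤ T → ∀ (I : Finset ι)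
      (g : ι → EuclideanSpace ℝ (Fin n)), (∀ l ∈ I, g l ∈ Γ ∩ S) →
      (∀ ρ : ℝ, 0 < ρ → ∀ y, ∀ J ⊆ I, (∀ l ∈ J, dist (g l) y < ρ * t) → J.card ≤ N ρ) →
      (I.card : ℝ) * t ^ (n - 1) ≤ C) ?_ ?_ ?_ ?_
  · refine ⟨0, fun t ht _ I g hI _ => ?_⟩
    have : I = ∅ := Finset.eq_empty_of_forall_notMem fun l hl => (hI l hl).2
    simp [this]
  · rintro S S' hS ⟨C, hC⟩
    exact ⟨C, fun t ht hT I g hI => hC t ht hT I g fun l hl => ⟨(hI l hl).1, hS (hI l hl).2⟩⟩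
  · rintro S S' ⟨C, hC⟩ ⟨C', hC'⟩
    refine ⟨C + C', fun t ht hT I g hI hov => ?_⟩
    have h1 := hC t ht hT (I.filter fun l => g l ∈ S) g
      (fun l hl => ⟨(hI l (Finset.filter_subset _ _ hl)).1, (Finset.mem_filter.1 hl).2⟩)
      (fun ρ hρ y J hJ => hov ρ hρ y J (hJ.trans (Finset.filter_subset _ _)))
    have h2 := hC' t ht hT (I.filter fun l => ¬ g l ∈ S) g
      (fun l hl => ⟨(hI l (Finset.filter_subset _ _ hl)).1,
        ((hI l (Finset.filter_subset _ _ hl)).2).resolve_left (Finset.mem_filter.1 hl).2⟩)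
      (fun ρ hρ y J hJ => hov ρ hρ y J (hJ.trans (Finset.filter_subset _ _)))
    have h3 := Finset.card_filter_add_card_filter_not (s := I) (fun l => g l ∈ S)
    rw [← h3]
    push_cast
    linarith
  · intro x hx
    obtain ⟨U, V, φ, L, hU, hxU, -, hφ, hL⟩ := hΓ x hx
    obtain ⟨ε, hε, hεU⟩ := Metric.isOpen_iff.1 hU x hxU
    obtain ⟨a, haV, hax⟩ : x ∈ φ '' V := hφ ▸ ⟨hx, hxU⟩
    -- The chart constant L is not known to be positive.
    set M : ℝ := max L 1
    have hM1 : 1 ≤ M := le_max_right _ _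
    have hM : ∀ p ∈ V, ∀ q ∈ V, dist (φ p) (φ q) ≤ M * dist p q ∧ dist p q ≤ M * dist (φ p) (φ q) :=
      fun p hp q hq => ⟨(hL p hp q hq).1.trans (by gcongr; exact le_max_left _ _),
        (hL p hp q hq).2.trans (by gcongr; exact le_max_left _ _)⟩
    refine ⟨ball x ε, mem_nhdsWithin_of_mem_nhds (ball_mem_nhds x hε),
      N (2 * M + 1) * (M * ε + T) ^ (n - 1), fun t ht hT I g hI hov => ?_⟩
    have hb : ∀ l, ∃ b, l ∈ I → b ∈ V ∧ φ b = g l := by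
      intro l
      by_cases hl : l ∈ I
      · obtain ⟨b, hb, hbl⟩ : g l ∈ φ '' V := hφ ▸ ⟨(hI l hl).1, hεU (hI l hl).2⟩
        exact ⟨b, fun _ => ⟨hb, hbl⟩⟩
      · exact ⟨a, fun h => absurd h hl⟩
    choose b hb using hb
    have h1 := card_mul_pow_le_of_overlap I b ht (R := M * ε) (by positivity) a (N (2 * M + 1)) ?_ ?_
    · refine h1.trans ?_
      gcongr
    · intro y J hJ hJy
      rcases J.eq_empty_or_nonempty with rfl | ⟨l₀, hl₀⟩
      · simp
      -- The centre y need not lie in the chart domain, so it is replaced by one of the points. Two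
      -- points within t of y are within 2t of each other and their images within 2Mt; the extra 1
      -- makes the inequality strict.
      · refine hov (2 * M + 1) (by positivity) (g l₀) J hJ fun l hl => ?_
        obtain ⟨h2, h3⟩ := hb l (hJ hl)
        obtain ⟨h4, h5⟩ := hb l₀ (hJ hl₀)
        rw [← h3, ← h5]
        have h6 := (hM _ h2 _ h4).1
        have h7 : dist (b l) (b l₀) ≤ 2 * t := by
          have := dist_triangle_right (b l) (b l₀) y
          linarith [hJy l hl, hJy l₀ hl₀]
        nlinarith
    · intro l hl
      obtain ⟨h2, h3⟩ := hb l hl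
      have h4 := (hM _ h2 _ haV).2
      rw [h3, hax] at h4
      have h5 : dist (g l) x ≤ ε := (mem_ball.1 (hI l hl).2).le
      exact h4.trans (by gcongr)

/-! ### Geometry of the Whitney balls -/

namespace IsWhitneyCovering

variable {n : ℕ} {ι : Type*} {Ω : Set (EuclideanSpace ℝ (Fin n))}
  {c : ι → EuclideanSpace ℝ (Fin n)} {r : ι → ℝ}

theorem setDist_pos (h : IsWhitneyCovering Ω c r) (i : ι) :
    0 < setDist (ball (c i) (r i)) (closure Ω \ Ω) := by
  obtain ⟨A, hA, hr⟩ := h.radius_equiv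
  have h1 := (h.radius_pos i).trans_le (hr i).2
  exact pos_of_mul_pos_right h1 hA.le

theorem setDist_le_dist {S T : Set (EuclideanSpace ℝ (Fin n))} {x y : EuclideanSpace ℝ (Fin n)}
    (hx : x ∈ S) (hy : y ∈ T) : setDist S T ≤ dist x y :=
  csInf_le ⟨0, by rintro _ ⟨a, -, b, -, rfl⟩; exact dist_nonneg⟩ ⟨x, hx, y, hy, rfl⟩

/-- If Γ were empty, `setDist` would be the infimum of the empty set, which is 0 by convention,
against `setDist_pos`. -/
theorem boundary_nonempty (h : IsWhitneyCovering Ω c r) (i : ι) : (closure Ω \ Ω).Nonempty := by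
  by_contra hne
  rw [Set.not_nonempty_iff_eq_empty] at hne
  have := h.setDist_pos i
  simp [hne, setDist] at this

theorem ball_subset (h : IsWhitneyCovering Ω c r) (i : ι) : ball (c i) (r i) ⊆ Ω :=
  h.iUnion_eq ▸ Set.subset_iUnion (fun i => ball (c i) (r i)) i

/-- A point of the closed ball outside Ω would belong to Γ and be at distance 0 from the open ball.
This keeps the supports of the localized symbols inside Ω, where m is smooth. -/
theorem closedBall_subset (h : IsWhitneyCovering Ω c r) (i : ι) :
    closedBall (c i) (r i) ⊆ Ω := by
  intro x hx
  by_contra hxΩ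
  rw [← closure_ball _ (h.radius_pos i).ne'] at hx
  have hxΓ : x ∈ closure Ω \ Ω := ⟨closure_mono (h.ball_subset i) hx, hxΩ⟩
  obtain ⟨y, hy, hxy⟩ := Metric.mem_closure_iff.1 hx _ (h.setDist_pos i)
  have := setDist_le_dist hy hxΓ
  rw [dist_comm] at hxy
  linarith

theorem exists_infDist_equiv (h : IsWhitneyCovering Ω c r) :
    ∃ a b : ℝ, 0 < a ∧ 0 < b ∧ ∀ i, ∀ ξ ∈ ball (c i) (r i),
      a * r i ≤ infDist ξ (closure Ω \ Ω) ∧ infDist ξ (closure Ω \ Ω) ≤ b * r i := by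
  obtain ⟨A, hA, hr⟩ := h.radius_equiv
  -- A + 3: at most A r for the distance of the sets, r for a nearly minimizing pair, 2r for
  -- crossing the ball.
  refine ⟨A⁻¹, A + 3, by positivity, by positivity, fun i ξ hξ => ⟨?_, ?_⟩⟩
  · rw [le_infDist (h.boundary_nonempty i)]
    intro y hy
    have := setDist_le_dist hξ hy
    have h2 := (hr i).2
    rw [inv_mul_le_iff₀ hA]
    exact h2.trans (by gcongr)
  · have hne : (Set.image2 dist (ball (c i) (r i)) (closure Ω \ Ω)).Nonempty :=
      Set.Nonempty.image2 ⟨ξ, hξ⟩ (h.boundary_nonempty i)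
    obtain ⟨_, ⟨x, hx, y, hy, rfl⟩, hxy⟩ := exists_lt_of_csInf_lt hne
      (lt_add_of_pos_right _ (h.radius_pos i))
    have h1 : setDist (ball (c i) (r i)) (closure Ω \ Ω) ≤ A * r i := by
      rw [← inv_mul_le_iff₀ hA]; exact (hr i).1
    have h2 := infDist_le_dist_of_mem (x := ξ) hy
    have h3 := dist_triangle ξ x y
    have h4 := dist_triangle_right ξ x (c i)
    rw [mem_ball] at hx hξ
    change dist x y < setDist _ _ + _ at hxy
    linarith

theorem exists_infDist_equiv_closedBall (h : IsWhitneyCovering Ω c r) :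
    ∃ a b : ℝ, 0 < a ∧ 0 < b ∧ ∀ i, ∀ ξ ∈ closedBall (c i) (r i),
      a * r i ≤ infDist ξ (closure Ω \ Ω) ∧ infDist ξ (closure Ω \ Ω) ≤ b * r i := by
  obtain ⟨a, b, ha, hb, hab⟩ := h.exists_infDist_equiv
  refine ⟨a, b, ha, hb, fun i ξ hξ => ?_⟩
  rw [← closure_ball _ (h.radius_pos i).ne'] at hξ
  have hcl : IsClosed {ξ | a * r i ≤ infDist ξ (closure Ω \ Ω) ∧
      infDist ξ (closure Ω \ Ω) ≤ b * r i} :=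
    (isClosed_le continuous_const (continuous_infDist_pt _)).inter
      (isClosed_le (continuous_infDist_pt _) continuous_const)
  exact closure_minimal (fun ξ hξ => hab i ξ hξ) hcl hξ

/-- At scale `t`, boundedly many balls have centres within a multiple of `t` of a point. -/
theorem exists_card_le (h : IsWhitneyCovering Ω c r) :
    ∃ N : ℝ → ℕ, ∀ ρ : ℝ, 0 < ρ → ∀ t : ℝ, 0 < t → ∀ I : Finset ι, (∀ l ∈ I, t ≤ r l) →
      ∀ y, (∀ l ∈ I, dist (c l) y < ρ * t) → I.card ≤ N ρ := by
  obtain ⟨N, hN⟩ := h.bounded_overlap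
  -- Balls of the smaller radius t about the centres keep the overlap N and lie within (ρ + 1) t of
  -- y.
  refine ⟨fun ρ => ⌈N * (ρ + 1) ^ n⌉₊, fun ρ hρ t ht I hI y hy => ?_⟩
  have h1 := card_mul_pow_le_of_overlap I c ht (R := ρ * t) (by positivity) y N ?_
    fun l hl => (hy l hl).le
  · rw [← Nat.cast_le (α := ℝ)]
    refine le_trans ?_ (Nat.le_ceil _)
    rw [show ρ * t + t = (ρ + 1) * t by ring, mul_pow, ← mul_assoc] at h1
    exact le_of_mul_le_mul_right h1 (by positivity)
  · intro z J hJ hz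
    have h2 := hN z
    have h3 : (J : Set ι) ⊆ {i | z ∈ ball (c i) (r i)} := fun l hl => by
      rw [Set.mem_ofPred_eq, mem_ball, dist_comm]
      exact (hz l hl).trans_le (hI l (hJ hl))
    have h4 := (Set.encard_le_encard h3).trans h2
    rw [Set.encard_coe_eq_coe_finsetCard] at h4
    exact_mod_cast h4

theorem exists_radius_le (h : IsWhitneyCovering Ω c r) (hn : 1 ≤ n)
    (hb : Bornology.IsBounded Ω) : ∃ R : ℝ, 0 < R ∧ ∀ i, r i ≤ R := by
  obtain ⟨D, hD, hΩ⟩ := hb.subset_ball_lt 0 0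
  refine ⟨D, hD, fun i => ?_⟩
  have : Nonempty (Fin n) := ⟨⟨0, hn⟩⟩
  have h1 : volume (ball (c i) (r i)) ≤ volume (ball (0 : EuclideanSpace ℝ (Fin n)) D) :=
    measure_mono ((h.ball_subset i).trans hΩ)
  by_contra! hlt
  have h0 : volume (ball (0 : EuclideanSpace ℝ (Fin n)) 1) ≠ 0 := (measure_ball_pos _ _ one_pos).ne'
  have h1' : volume (ball (0 : EuclideanSpace ℝ (Fin n)) 1) ≠ ⊤ := measure_ball_lt_top.ne
  rw [Measure.addHaar_ball_of_pos _ _ (h.radius_pos i), Measure.addHaar_ball_of_pos _ _ hD,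
    ENNReal.mul_le_mul_iff_left h0 h1', ENNReal.ofReal_le_ofReal_iff (by positivity)] at h1
  refine absurd h1 (not_le.2 (pow_lt_pow_left₀ hlt hD.le ?_))
  simpa using by omega

/-- Each centre is moved to a nearest point of Γ. The displacement is at most 2bt, so points crowded
on Γ at dilation ρ come from centres crowded at dilation ρ + 2b, and counting on the hypersurface
applies. -/
theorem exists_card_mul_pow_le (h : IsWhitneyCovering Ω c r) (hn : 1 ≤ n)
    (hb : Bornology.IsBounded Ω) (hΩ : IsOpen Ω)
    (hΓ : IsLipschitzHypersurface (closure Ω \ Ω)) :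
    ∃ C : ℝ, ∀ t : ℝ, 0 < t → ∀ I : Finset ι, (∀ l ∈ I, t ≤ r l ∧ r l < 2 * t) →
      (I.card : ℝ) * t ^ (n - 1) ≤ C := by
  obtain ⟨R, hR, hrR⟩ := h.exists_radius_le hn hb
  obtain ⟨N, hN⟩ := h.exists_card_le
  obtain ⟨a, b, ha, hb', hab⟩ := h.exists_infDist_equiv
  have hcomp : IsCompact (closure Ω \ Ω) := hb.isCompact_closure.diff hΩ
  obtain ⟨C, hC⟩ := hΓ.card_mul_pow_le hcomp R (fun ρ => N (ρ + 2 * b)) ι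
  -- When t exceeds every radius the family is empty and only a nonnegative constant is needed; a
  -- nonempty family forces t ≤ R.
  refine ⟨max C 0, fun t ht I hI => ?_⟩
  rcases I.eq_empty_or_nonempty with rfl | ⟨l₀, hl₀⟩
  · simp
  have hg : ∀ l, ∃ y ∈ closure Ω \ Ω, dist (c l) y ≤ b * r l := by
    intro l
    obtain ⟨y, hy, hy'⟩ := hcomp.exists_infDist_eq_dist (h.boundary_nonempty l) (c l)
    exact ⟨y, hy, hy' ▸ (hab l (c l) (mem_ball_self (h.radius_pos l))).2⟩
  choose g hg hgd using hg
  refine (hC t ht ((hI l₀ hl₀).1.trans (hrR l₀)) I g (fun l _ => hg l) ?_).trans (le_max_left _ _)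
  intro ρ hρ y J hJ hJy
  refine hN (ρ + 2 * b) (by positivity) t ht J (fun l hl => (hI l (hJ hl)).1) y fun l hl => ?_
  have h1 := dist_triangle (c l) (g l) y
  have h2 := hgd l
  have h3 := hJy l hl
  have h4 : b * r l ≤ b * (2 * t) := by gcongr; exact (hI l (hJ hl)).2.le
  linarith

end IsWhitneyCovering

/-! ### The maximal function of a doubling measure -/

noncomputable section

/-- The uncentred maximal function over balls with respect to a measure `μ`. -/
def ballMaximal {α : Type*} [PseudoMetricSpace α] [MeasurableSpace α] (μ : Measure α)
    (g : α → ℝ≥0∞) (x : α) : ℝ≥0∞ :=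
  ⨆ (z : α) (ρ : ℝ) (_ : x ∈ ball z ρ), ⨍⁻ y in ball z ρ, g y ∂μ

section Maximal

variable {α : Type*} [PseudoMetricSpace α] [MeasurableSpace α] {μ : Measure α}

theorem lt_ballMaximal_iff {g : α → ℝ≥0∞} {x : α} {a : ℝ≥0∞} :
    a < ballMaximal μ g x ↔ ∃ z ρ, x ∈ ball z ρ ∧ a < ⨍⁻ y in ball z ρ, g y ∂μ := by
  simp [ballMaximal, lt_iSup_iff]

theorem laverage_le_ballMaximal {g : α → ℝ≥0∞} {x z : α} {ρ : ℝ} (hx : x ∈ ball z ρ) :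
    ⨍⁻ y in ball z ρ, g y ∂μ ≤ ballMaximal μ g x :=
  le_iSup_of_le z (le_iSup_of_le ρ (le_iSup_of_le hx le_rfl))

theorem ballMaximal_le {g : α → ℝ≥0∞} {x : α} {a : ℝ≥0∞}
    (h : ∀ z ρ, x ∈ ball z ρ → ⨍⁻ y in ball z ρ, g y ∂μ ≤ a) : ballMaximal μ g x ≤ a :=
  iSup_le fun z => iSup_le fun ρ => iSup_le fun hx => h z ρ hx

theorem ballMaximal_congr {g h : α → ℝ≥0∞} (hgh : g =ᵐ[μ] h) :
    ballMaximal μ g = ballMaximal μ h := by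
  funext x
  simp only [ballMaximal]
  refine iSup_congr fun z => iSup_congr fun ρ => iSup_congr fun _ => ?_
  rw [setLAverage_eq, setLAverage_eq, lintegral_congr_ae (ae_restrict_of_ae hgh)]

/-- For the uncentred operator a superlevel set is a union of balls; hence the maximal function of
any g, measurable or not, is measurable. -/
theorem isOpen_lt_ballMaximal (g : α → ℝ≥0∞) (a : ℝ≥0∞) : IsOpen {x | a < ballMaximal μ g x} := by
  have : {x | a < ballMaximal μ g x} =
      ⋃ (z) (ρ) (_ : a < ⨍⁻ y in ball z ρ, g y ∂μ), ball z ρ := by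
    ext x
    simp only [Set.mem_ofPred_eq, lt_ballMaximal_iff, Set.mem_iUnion, exists_prop]
    exact exists_congr fun z => exists_congr fun ρ => and_comm
  rw [this]
  exact isOpen_iUnion fun z => isOpen_iUnion fun ρ => isOpen_iUnion fun _ => isOpen_ball

theorem measurable_ballMaximal [OpensMeasurableSpace α] (g : α → ℝ≥0∞) :
    Measurable (ballMaximal μ g) :=
  measurable_of_Ioi fun a => (isOpen_lt_ballMaximal g a).measurableSet

/-- Truncation: the part of g below a adds at most a to any average. It turns the weak type bound
into one involving only the set where g exceeds a. -/
theorem ballMaximal_le_add (g : α → ℝ≥0∞) {a : ℝ≥0∞} (x : α) :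
    ballMaximal μ g x ≤ ballMaximal μ ({y | a < g y}.indicator g) x + a := by
  refine ballMaximal_le fun z ρ hx => ?_
  have h1 : ∀ y, g y ≤ {y | a < g y}.indicator g y + a := by
    intro y
    by_cases hy : a < g y
    · rw [Set.indicator_of_mem (by exact hy)]
      exact le_self_add
    · rw [Set.indicator_of_notMem (by exact hy), zero_add]
      exact not_lt.1 hy
  calc ⨍⁻ y in ball z ρ, g y ∂μ
      ≤ ⨍⁻ y in ball z ρ, ({y | a < g y}.indicator g y + a) ∂μ := lintegral_mono h1
    _ = ⨍⁻ y in ball z ρ, {y | a < g y}.indicator g y ∂μ + ⨍⁻ y in ball z ρ, a ∂μ :=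
        lintegral_add_right _ measurable_const
    _ ≤ _ := by
        gcongr
        · exact laverage_le_ballMaximal hx
        · rw [setLAverage_eq, setLIntegral_const]
          exact ENNReal.div_le_of_le_mul le_rfl

/-- Weak type `(1, 1)` of the maximal function of a doubling measure. -/
theorem mul_measure_lt_ballMaximal_le [OpensMeasurableSpace α] [SecondCountableTopology α]
    {D : ℝ≥0∞} (hD : ∀ z ρ, 0 < ρ → μ (closedBall z (4 * ρ)) ≤ D * μ (ball z ρ))
    (g : α → ℝ≥0∞) (a : ℝ≥0∞) :
    a * μ {x | a < ballMaximal μ g x} ≤ D * ∫⁻ x, g x ∂μ := by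
  -- The Vitali covering lemma needs bounded radii, so they are capped at R and R tends to infinity
  -- at the end.
  set T : ℕ → Set (α × ℝ) := fun R =>
    {b | 0 < b.2 ∧ b.2 ≤ R ∧ a < ⨍⁻ y in ball b.1 b.2, g y ∂μ}
  have hT : {x | a < ballMaximal μ g x} ⊆ ⋃ R, ⋃ b ∈ T R, ball b.1 b.2 := by
    intro x hx
    obtain ⟨z, ρ, hxz, hlt⟩ := lt_ballMaximal_iff.1 hx
    obtain ⟨R, hR⟩ := exists_nat_ge ρ
    simp only [Set.mem_iUnion]
    exact ⟨R, (z, ρ), ⟨pos_of_mem_ball hxz, hR, hlt⟩, hxz⟩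
  have hmono : Monotone fun R => ⋃ b ∈ T R, ball b.1 b.2 := by
    intro R S hRS
    refine Set.biUnion_subset_biUnion_left fun b hb => ⟨hb.1, hb.2.1.trans ?_, hb.2.2⟩
    exact_mod_cast hRS
  refine (mul_le_mul_right (measure_mono hT) a).trans ?_
  rw [hmono.measure_iUnion, ENNReal.mul_iSup]
  refine iSup_le fun R => ?_
  obtain ⟨u, huT, hdisj, hcov⟩ := Vitali.exists_disjoint_subfamily_covering_enlargement_closedBall
    (T R) (fun b => b.1) (fun b => b.2) R (fun b hb => hb.2.1) 4 (by norm_num)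
  have hdisj' : u.PairwiseDisjoint fun b => ball b.1 b.2 :=
    hdisj.mono fun b => ball_subset_closedBall
  have hcount : u.Countable := hdisj'.countable_of_isOpen (fun b _ => isOpen_ball)
    fun b hb => ⟨b.1, mem_ball_self (huT hb).1⟩
  have hsub : (⋃ b ∈ T R, ball b.1 b.2) ⊆ ⋃ b ∈ u, closedBall b.1 (4 * b.2) := by
    refine Set.iUnion₂_subset fun b hb => ?_
    obtain ⟨b', hb', hbb⟩ := hcov b hb
    exact (ball_subset_closedBall.trans hbb).trans (Set.subset_biUnion_of_mem (u := fun b : α × ℝ => closedBall b.1 (4 * b.2)) hb')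
  calc a * μ (⋃ b ∈ T R, ball b.1 b.2)
      ≤ a * ∑' b : u, μ (closedBall b.1.1 (4 * b.1.2)) := by
        gcongr
        exact (measure_mono hsub).trans (measure_biUnion_le μ hcount _)
    _ ≤ a * ∑' b : u, D * μ (ball b.1.1 b.1.2) := by
        gcongr with b
        exact hD _ _ (huT b.2).1
    _ = D * ∑' b : u, a * μ (ball b.1.1 b.1.2) := by
        rw [ENNReal.tsum_mul_left, ENNReal.tsum_mul_left]; ring
    _ ≤ D * ∑' b : u, ∫⁻ y in ball b.1.1 b.1.2, g y ∂μ := by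
        gcongr with b
        have := (huT b.2).2.2
        rw [setLAverage_eq] at this
        exact ENNReal.mul_le_of_le_div this.le
    _ = D * ∫⁻ y in ⋃ b ∈ u, ball b.1 b.2, g y ∂μ := by
        rw [lintegral_biUnion hcount (fun b _ => measurableSet_ball) hdisj']
    _ ≤ D * ∫⁻ x, g x ∂μ := by
        gcongr
        exact Measure.restrict_le_self

theorem mul_measure_two_mul_lt_ballMaximal_le [OpensMeasurableSpace α] [SecondCountableTopology α]
    {D : ℝ≥0∞} (hD : ∀ z ρ, 0 < ρ → μ (closedBall z (4 * ρ)) ≤ D * μ (ball z ρ))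
    {g : α → ℝ≥0∞} (hg : Measurable g) (a : ℝ≥0∞) :
    a * μ {x | 2 * a < ballMaximal μ g x} ≤ D * ∫⁻ x in {y | a < g y}, g x ∂μ := by
  rw [← lintegral_indicator (measurableSet_lt measurable_const hg)]
  refine le_trans ?_ (mul_measure_lt_ballMaximal_le hD _ a)
  refine mul_le_mul' le_rfl (measure_mono fun x hx => ?_)
  have := hx.out.trans_le (ballMaximal_le_add g (a := a) x)
  rw [two_mul] at this
  exact lt_of_add_lt_add_right this

/-- Where g > N + 1 one has g ≤ g^p, so N times the measure of the infinity set is at most D ∫ g^p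
for every N. The layer-cake formula below concerns real-valued functions and needs this. -/
theorem ae_ballMaximal_lt_top [OpensMeasurableSpace α] [SecondCountableTopology α]
    {D : ℝ≥0∞} (hDt : D ≠ ⊤)
    (hD : ∀ z ρ, 0 < ρ → μ (closedBall z (4 * ρ)) ≤ D * μ (ball z ρ)) {p : ℝ} (hp : 1 < p)
    {g : α → ℝ≥0∞} (hg : Measurable g) (hgp : ∫⁻ x, g x ^ p ∂μ ≠ ⊤) :
    ∀ᵐ x ∂μ, ballMaximal μ g x < ⊤ := by
  rw [ae_iff]
  by_contra hne
  obtain ⟨N, hN⟩ := ENNReal.exists_nat_mul_gt hne (ENNReal.mul_ne_top hDt hgp)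
  have h1 := mul_measure_two_mul_lt_ballMaximal_le hD hg (N + 1)
  have h2 : ∫⁻ x in {y | (N : ℝ≥0∞) + 1 < g y}, g x ∂μ ≤ ∫⁻ x, g x ^ p ∂μ := by
    rw [← lintegral_indicator (measurableSet_lt measurable_const hg)]
    refine lintegral_mono (Set.indicator_le fun y hy => ?_)
    have : 1 ≤ g y := le_add_self.trans (le_of_lt hy)
    simpa using ENNReal.rpow_le_rpow_of_exponent_le this hp.le
  refine absurd hN (not_lt.2 ?_)
  calc (N : ℝ≥0∞) * μ {x | ¬ ballMaximal μ g x < ⊤}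
      ≤ (N + 1) * μ {x | 2 * ((N : ℝ≥0∞) + 1) < ballMaximal μ g x} := by
        gcongr with x
        · exact le_self_add
        · intro hx
          rw [not_lt, top_le_iff] at hx
          rw [hx]
          finiteness
    _ ≤ _ := h1.trans (by gcongr)

/-- The maximal function of a doubling measure is bounded on `L^p`, `1 < p < ∞`. -/
theorem exists_lintegral_ballMaximal_rpow_le [OpensMeasurableSpace α] [SecondCountableTopology α]
    {D : ℝ≥0∞} (hDt : D ≠ ⊤)
    (hD : ∀ z ρ, 0 < ρ → μ (closedBall z (4 * ρ)) ≤ D * μ (ball z ρ)) {p : ℝ} (hp : 1 < p) :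
    ∃ C : ℝ≥0∞, C ≠ ⊤ ∧ ∀ g : α → ℝ≥0∞, AEMeasurable g μ →
      ∫⁻ x, ballMaximal μ g x ^ p ∂μ ≤ C * ∫⁻ x, g x ^ p ∂μ := by
  have hp0 : 0 < p := by linarith
  have hp1 : 0 < p - 1 := by linarith
  -- It suffices to treat finite measurable functions in L^p. If ∫ g^p is infinite the bound is
  -- trivial, provided C ≠ 0, because 0 * ⊤ = 0.
  suffices h : ∃ C : ℝ≥0∞, C ≠ ⊤ ∧ C ≠ 0 ∧ ∀ f : α → ℝ≥0, Measurable f →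
      ∫⁻ x, (f x : ℝ≥0∞) ^ p ∂μ ≠ ⊤ →
      ∫⁻ x, ballMaximal μ (fun x => f x) x ^ p ∂μ ≤ C * ∫⁻ x, (f x : ℝ≥0∞) ^ p ∂μ by
    obtain ⟨C, hC, hC0, h⟩ := h
    refine ⟨C, hC, fun g hg => ?_⟩
    by_cases hgt : ∫⁻ x, g x ^ p ∂μ = ⊤
    · rw [hgt, ENNReal.mul_top hC0]; exact le_top
    have hlt : ∀ᵐ x ∂μ, g x ^ p < ⊤ := ae_lt_top' (hg.pow_const p) hgt
    have hae : g =ᵐ[μ] fun x => ((hg.mk g x).toNNReal : ℝ≥0∞) := by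
      filter_upwards [hlt, hg.ae_eq_mk] with x hx hx'
      rw [← hx', ENNReal.coe_toNNReal]
      rintro h
      simp [h, hp0] at hx
    have hae' : (fun x => g x ^ p) =ᵐ[μ] fun x => ((hg.mk g x).toNNReal : ℝ≥0∞) ^ p := by
      filter_upwards [hae] with x hx
      rw [hx]
    rw [ballMaximal_congr hae, lintegral_congr_ae hae']
    exact h _ hg.measurable_mk.ennreal_toNNReal (by rwa [← lintegral_congr_ae hae'])
  refine ⟨ENNReal.ofReal p * (2 * D * (ENNReal.ofReal (p - 1))⁻¹ * 2 ^ (p - 1)) + 1, by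
    have := ENNReal.ofReal_pos.2 hp1; finiteness, by simp, fun f hf hfp => ?_⟩
  set g : α → ℝ≥0∞ := fun x => f x
  have hg : Measurable g := hf.coe_nnreal_ennreal
  have hfin := ae_ballMaximal_lt_top hDt hD hp hg hfp
  have e1 : ∫⁻ x, ballMaximal μ g x ^ p ∂μ =
      ∫⁻ x, ENNReal.ofReal ((ballMaximal μ g x).toReal ^ p) ∂μ := by
    refine lintegral_congr_ae ?_
    filter_upwards [hfin] with x hx
    rw [← ENNReal.ofReal_rpow_of_nonneg ENNReal.toReal_nonneg hp0.le, ENNReal.ofReal_toReal hx.ne]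
  have e2 : ∫⁻ x, ENNReal.ofReal ((2 * (f x : ℝ)) ^ (p - 1)) ∂(μ.withDensity g) =
      2 ^ (p - 1) * ∫⁻ x, g x ^ p ∂μ := by
    rw [lintegral_withDensity_eq_lintegral_mul _ hg (by fun_prop), ← lintegral_const_mul _ (by fun_prop)]
    refine lintegral_congr fun x => ?_
    simp only [Pi.mul_apply, g]
    rw [← ENNReal.ofReal_rpow_of_nonneg (by positivity) hp1.le, ENNReal.ofReal_mul (by norm_num),
      ENNReal.ofReal_coe_nnreal, ENNReal.mul_rpow_of_nonneg _ _ hp1.le, ENNReal.ofReal_ofNat]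
    by_cases h0 : f x = 0
    · simp [h0, hp0]
    have : (f x : ℝ≥0∞) ^ p = f x * (f x : ℝ≥0∞) ^ (p - 1) := by
      conv_lhs => rw [show p = 1 + (p - 1) by ring]
      rw [ENNReal.rpow_add _ _ (by simpa using h0) (by simp), ENNReal.rpow_one]
    rw [this]; ring
  -- A second layer cake, for 2f with exponent p - 1 and the measure g dμ, replaces the usual
  -- interchange of integrals.
  have e3 := lintegral_rpow_eq_lintegral_meas_lt_mul (μ.withDensity g)
    (f := fun x => 2 * (f x : ℝ)) (Filter.Eventually.of_forall fun x => by positivity)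
    (by fun_prop) hp1
  rw [e1, lintegral_rpow_eq_lintegral_meas_lt_mul μ
    (Filter.Eventually.of_forall fun x => ENNReal.toReal_nonneg)
    (measurable_ballMaximal g).ennreal_toReal.aemeasurable hp0]
  have e4 : ∫⁻ t in Set.Ioi (0 : ℝ), μ {x | t < (ballMaximal μ g x).toReal} * ENNReal.ofReal (t ^ (p - 1)) ≤
      2 * D * ∫⁻ t in Set.Ioi (0 : ℝ),
        (μ.withDensity g) {x | t < 2 * (f x : ℝ)} * ENNReal.ofReal (t ^ (p - 1 - 1)) := by
    rw [← lintegral_const_mul' _ _ (by finiteness)]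
    refine setLIntegral_mono' measurableSet_Ioi fun t ht => ?_
    have ht' : (0 : ℝ) < t := ht
    -- The weak type bound is used at level t/2; one power of t is written as 2a to supply its left
    -- factor.
    set a := ENNReal.ofReal (t / 2)
    have ha0 : a ≠ 0 := (ENNReal.ofReal_pos.2 (by positivity)).ne'
    have h2a : 2 * a = ENNReal.ofReal t := by
      conv_rhs => rw [show t = 2 * (t / 2) by ring, ENNReal.ofReal_mul (by norm_num), ENNReal.ofReal_ofNat]
    have h1 := mul_measure_two_mul_lt_ballMaximal_le hD hg a
    have h2 : μ {x | t < (ballMaximal μ g x).toReal} ≤ μ {x | 2 * a < ballMaximal μ g x} := by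
      gcongr with x
      intro hx
      rw [h2a]
      by_cases hx' : ballMaximal μ g x = ⊤
      · simp [hx']
      · exact (ENNReal.ofReal_lt_iff_lt_toReal ht'.le hx').2 hx
    have h3 : {x | t < 2 * (f x : ℝ)} = {y | a < g y} := by
      ext x
      simp only [Set.mem_ofPred_eq, a, g]
      rw [ENNReal.ofReal_lt_iff_lt_toReal (by positivity) (by simp), ENNReal.coe_toReal]
      constructor <;> intro h <;> linarith
    have h4 : ENNReal.ofReal (t ^ (p - 1)) = 2 * (a * ENNReal.ofReal (t ^ (p - 1 - 1))) := by
      rw [← mul_assoc, h2a, ← ENNReal.ofReal_mul ht'.le]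
      congr 1
      rw [Real.rpow_sub_one ht'.ne' (p - 1)]
      field_simp
    rw [h3, withDensity_apply _ (measurableSet_lt measurable_const hg), h4]
    calc _ ≤ μ {x | 2 * a < ballMaximal μ g x} * (2 * (a * ENNReal.ofReal (t ^ (p - 1 - 1)))) := by
          gcongr
      _ = 2 * (a * μ {x | 2 * a < ballMaximal μ g x}) * ENNReal.ofReal (t ^ (p - 1 - 1)) := by ring
      _ ≤ 2 * (D * ∫⁻ x in {y | a < g y}, g x ∂μ) * ENNReal.ofReal (t ^ (p - 1 - 1)) := by gcongr
      _ = _ := by ring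
  refine (mul_le_mul_right e4 _).trans ?_
  rw [e2] at e3
  have hq0 := (ENNReal.ofReal_pos.2 hp1).ne'
  have e5 : ∫⁻ t in Set.Ioi (0 : ℝ),
        (μ.withDensity g) {x | t < 2 * (f x : ℝ)} * ENNReal.ofReal (t ^ (p - 1 - 1)) =
      (ENNReal.ofReal (p - 1))⁻¹ * (2 ^ (p - 1) * ∫⁻ x, g x ^ p ∂μ) := by
    rw [e3, ← mul_assoc, ENNReal.inv_mul_cancel hq0 ENNReal.ofReal_ne_top, one_mul]
  rw [e5, add_mul]
  refine le_trans (le_of_eq ?_) le_self_add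
  ring

end Maximal

end

/-! ### Muckenhoupt weights and Lerner's proof of the weighted maximal theorem -/

noncomputable section

section Muckenhoupt

variable {n : ℕ}

theorem volume_ball_mul (z : EuclideanSpace ℝ (Fin n)) {κ ρ : ℝ} (hκ : 0 < κ) (hρ : 0 < ρ) :
    volume (ball z (κ * ρ)) = ENNReal.ofReal (κ ^ n) * volume (ball z ρ) := by
  rw [Measure.addHaar_ball_of_pos _ _ hρ, Measure.addHaar_ball_of_pos _ _ (mul_pos hκ hρ),
    mul_pow, ENNReal.ofReal_mul (by positivity), finrank_euclideanSpace_fin, mul_assoc]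

theorem ENNReal.mul_rpow_conj {q : ℝ} (hq : 1 < q) {a : ℝ≥0∞} (h0 : a ≠ 0) (ht : a ≠ ⊤) :
    a ^ (1 / q) * (a ^ (1 - q / (q - 1))) ^ ((q - 1) / q) = 1 := by
  have h1 : q - 1 ≠ 0 := by linarith
  have h2 : q ≠ 0 := by linarith
  rw [← ENNReal.rpow_mul, ← ENNReal.rpow_add _ _ h0 ht,
    show 1 / q + (1 - q / (q - 1)) * ((q - 1) / q) = 0 by field_simp; ring, ENNReal.rpow_zero]

/-- Hölder's inequality for 1 = w^(1/q) σ^((q-1)/q), with dual weight σ = w^(1-q'). This is the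
inequality opposite to the A_q condition. -/
theorem volume_rpow_le_mul {q : ℝ} (hq : 1 < q) {w : EuclideanSpace ℝ (Fin n) → ℝ≥0∞} (hw : Measurable w)
    (h0 : ∀ y, w y ≠ 0) (ht : ∀ y, w y ≠ ⊤) (S : Set (EuclideanSpace ℝ (Fin n))) :
    volume S ^ q ≤ (∫⁻ y in S, w y) * (∫⁻ y in S, w y ^ (1 - q / (q - 1))) ^ (q - 1) := by
  have h1 := ENNReal.lintegral_mul_norm_pow_le (μ := volume.restrict S) (f := w)
    (g := fun y => w y ^ (1 - q / (q - 1))) hw.aemeasurable (hw.pow_const _).aemeasurable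
    (p := 1 / q) (q := (q - 1) / q) (by positivity) (div_nonneg (by linarith) (by linarith))
    (by field_simp; ring)
  simp_rw [fun y => ENNReal.mul_rpow_conj hq (h0 y) (ht y)] at h1
  rw [lintegral_one, Measure.restrict_apply_univ] at h1
  have hq0 : q ≠ 0 := by linarith
  refine (ENNReal.rpow_le_rpow h1 (by linarith : 0 ≤ q)).trans (le_of_eq ?_)
  rw [ENNReal.mul_rpow_of_nonneg _ _ (by linarith), ← ENNReal.rpow_mul, ← ENNReal.rpow_mul,
    one_div_mul_cancel hq0, ENNReal.rpow_one, div_mul_cancel₀ _ hq0]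

variable {q : ℝ} {w : EuclideanSpace ℝ (Fin n) → ℝ≥0∞} {C : ℝ≥0∞}

/-- The A_q condition on the large ball is compared with Hölder's inequality on the small one;
monotonicity in one of the two factors leaves doubling for the other. The factor 5 allows an open
ball around the closed ball of radius 4ρ. -/
theorem muckenhoupt_doubling (hq : 1 < q) (hw : Measurable w)
    (h0 : ∀ y, w y ≠ 0) (ht : ∀ y, w y ≠ ⊤)
    (hA : ∀ (z : EuclideanSpace ℝ (Fin n)) (ρ : ℝ), 0 < ρ → (∫⁻ y in ball z ρ, w y) *
      (∫⁻ y in ball z ρ, w y ^ (1 - q / (q - 1))) ^ (q - 1) ≤ C * volume (ball z ρ) ^ q)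
    (z : EuclideanSpace ℝ (Fin n)) {ρ : ℝ} (hρ : 0 < ρ) :
    volume.withDensity w (closedBall z (4 * ρ)) ≤
        C * ENNReal.ofReal (5 ^ n) ^ q * volume.withDensity w (ball z ρ) ∧
      volume.withDensity (fun y => w y ^ (1 - q / (q - 1))) (closedBall z (4 * ρ)) ≤
        (C * ENNReal.ofReal (5 ^ n) ^ q) ^ (1 / (q - 1)) *
          volume.withDensity (fun y => w y ^ (1 - q / (q - 1))) (ball z ρ) := by
  have hq1 : 0 < q - 1 := by linarith
  have hsub : closedBall z (4 * ρ) ⊆ ball z (5 * ρ) := closedBall_subset_ball (by linarith)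
  have hsub' : ball z ρ ⊆ ball z (5 * ρ) := ball_subset_ball (by linarith)
  have hV0 : volume (ball z ρ) ^ q ≠ 0 :=
    (ENNReal.rpow_pos (measure_ball_pos volume z hρ) measure_ball_lt_top.ne).ne'
  have hVt : volume (ball z ρ) ^ q ≠ ⊤ :=
    ENNReal.rpow_ne_top_of_nonneg (by linarith) measure_ball_lt_top.ne
  have hV := volume_rpow_le_mul hq hw h0 ht (ball z ρ)
  have hA' := hA z (5 * ρ) (by positivity)
  rw [volume_ball_mul z (by norm_num) hρ, ENNReal.mul_rpow_of_nonneg _ _ (by linarith),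
    ← mul_assoc] at hA'
  set σ : EuclideanSpace ℝ (Fin n) → ℝ≥0∞ := fun y => w y ^ (1 - q / (q - 1)) with hσ
  have hmw : ∫⁻ y in ball z ρ, w y ≤ ∫⁻ y in ball z (5 * ρ), w y := lintegral_mono_set hsub'
  have hmσ : ∫⁻ y in ball z ρ, σ y ≤ ∫⁻ y in ball z (5 * ρ), σ y := lintegral_mono_set hsub'
  constructor
  · refine le_trans (measure_mono hsub) ?_
    rw [withDensity_apply _ measurableSet_ball, withDensity_apply _ measurableSet_ball,
      ← ENNReal.mul_le_mul_iff_left hV0 hVt]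
    calc (∫⁻ y in ball z (5 * ρ), w y) * volume (ball z ρ) ^ q
        ≤ (∫⁻ y in ball z (5 * ρ), w y) * ((∫⁻ y in ball z ρ, w y) *
            (∫⁻ y in ball z (5 * ρ), σ y) ^ (q - 1)) := by
          gcongr
          exact hV.trans (by gcongr)
      _ = ((∫⁻ y in ball z (5 * ρ), w y) * (∫⁻ y in ball z (5 * ρ), σ y) ^ (q - 1)) *
            ∫⁻ y in ball z ρ, w y := by ring
      _ ≤ _ := by
          refine (mul_le_mul_left hA' _).trans (le_of_eq ?_)
          ring
  · refine le_trans (measure_mono hsub) ?_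
    rw [withDensity_apply _ measurableSet_ball, withDensity_apply _ measurableSet_ball,
      ← ENNReal.rpow_le_rpow_iff hq1, ENNReal.mul_rpow_of_nonneg _ _ hq1.le, ← ENNReal.rpow_mul,
      one_div_mul_cancel hq1.ne', ENNReal.rpow_one, ← ENNReal.mul_le_mul_iff_left hV0 hVt]
    calc (∫⁻ y in ball z (5 * ρ), σ y) ^ (q - 1) * volume (ball z ρ) ^ q
        ≤ (∫⁻ y in ball z (5 * ρ), σ y) ^ (q - 1) * ((∫⁻ y in ball z (5 * ρ), w y) *
            (∫⁻ y in ball z ρ, σ y) ^ (q - 1)) := by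
          gcongr
          exact hV.trans (by gcongr)
      _ = ((∫⁻ y in ball z (5 * ρ), w y) * (∫⁻ y in ball z (5 * ρ), σ y) ^ (q - 1)) *
            (∫⁻ y in ball z ρ, σ y) ^ (q - 1) := by ring
      _ ≤ _ := by
          refine (mul_le_mul_left hA' _).trans (le_of_eq ?_)
          ring

/-- Lerner's pointwise bound of the maximal function by weighted maximal functions. -/
theorem ballMaximal_rpow_le (hq : 1 < q) (hC : C ≠ ⊤) (hw : Measurable w)
    (h0 : ∀ y, w y ≠ 0) (ht : ∀ y, w y ≠ ⊤)
    (hA : ∀ (z : EuclideanSpace ℝ (Fin n)) (ρ : ℝ), 0 < ρ → (∫⁻ y in ball z ρ, w y) *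
      (∫⁻ y in ball z ρ, w y ^ (1 - q / (q - 1))) ^ (q - 1) ≤ C * volume (ball z ρ) ^ q)
    (g : EuclideanSpace ℝ (Fin n) → ℝ≥0∞) (x : EuclideanSpace ℝ (Fin n)) :
    ballMaximal volume g x ^ (q - 1) ≤ C * ballMaximal (volume.withDensity w) (fun y =>
      ballMaximal (volume.withDensity fun y => w y ^ (1 - q / (q - 1)))
        (fun y => g y / w y ^ (1 - q / (q - 1))) y ^ (q - 1) / w y) x := by
  have hq1 : 0 < q - 1 := by linarith
  set σ : EuclideanSpace ℝ (Fin n) → ℝ≥0∞ := fun y => w y ^ (1 - q / (q - 1)) with hσ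
  have hσm : Measurable σ := hw.pow_const _
  have hσ0 : ∀ y, σ y ≠ 0 := fun y => (ENNReal.rpow_pos (pos_iff_ne_zero.2 (h0 y)) (ht y)).ne'
  have hσt : ∀ y, σ y ≠ ⊤ := fun y => ENNReal.rpow_ne_top_of_ne_zero (h0 y) (ht y)
  set G := ballMaximal (volume.withDensity σ) (fun y => g y / σ y) with hG
  have hGm : Measurable G := measurable_ballMaximal _
  rw [← ENNReal.le_rpow_inv_iff hq1]
  refine ballMaximal_le fun z ρ hx => ?_
  rw [ENNReal.le_rpow_inv_iff hq1]
  have hρ := pos_of_mem_ball hx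
  set B := ball z ρ with hB
  set V := volume B with hVdef
  have hV0 : V ≠ 0 := (measure_ball_pos (volume : Measure (EuclideanSpace ℝ (Fin n))) z hρ).ne'
  have hVt : V ≠ ⊤ := measure_ball_lt_top.ne
  have hA1 := hA z ρ hρ
  change (∫⁻ y in B, w y) * (∫⁻ y in B, σ y) ^ (q - 1) ≤ C * V ^ q at hA1
  have hpos : ∀ u : EuclideanSpace ℝ (Fin n) → ℝ≥0∞, Measurable u → (∀ y, u y ≠ 0) → ∫⁻ y in B, u y ≠ 0 := by
    intro u hu hu0 h
    rw [lintegral_eq_zero_iff hu] at h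
    have : volume.restrict B = 0 := by
      rw [← ae_eq_bot]
      by_contra hne
      have : (ae (volume.restrict B)).NeBot := ⟨hne⟩
      obtain ⟨y, hy⟩ := h.exists
      exact hu0 y hy
    rw [Measure.restrict_eq_zero] at this
    exact hV0 this
  have hW0 := hpos w hw h0
  have hS0 := hpos σ hσm hσ0
  set W := ∫⁻ y in B, w y
  set S := ∫⁻ y in B, σ y
  -- A_q makes this product finite; as neither factor vanishes, both are finite and may be
  -- cancelled.
  have hprod : W * S ^ (q - 1) ≠ ⊤ := ne_top_of_le_ne_top
    (ENNReal.mul_ne_top hC (ENNReal.rpow_ne_top_of_nonneg (by linarith) hVt)) hA1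
  have hSt : S ≠ ⊤ := by
    intro h
    rw [h, ENNReal.top_rpow_of_pos hq1, ENNReal.mul_top hW0] at hprod
    exact hprod rfl
  have hWt : W ≠ ⊤ := by
    intro h
    rw [h, ENNReal.top_mul (ENNReal.rpow_pos (pos_iff_ne_zero.2 hS0) hSt).ne'] at hprod
    exact hprod rfl
  -- A is the σ-average of g/σ over B, so A ≤ G on B. By A_q, the (q-1)-th power of the average of g
  -- is at most C A^(q-1) |B| / w(B), and |B| / w(B) is the w-average of 1/w.
  set A := (∫⁻ y in B, g y) / S with hAdef
  have hAG : ∀ y ∈ B, A ≤ G y := by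
    intro y hy
    refine le_trans (le_of_eq ?_) (laverage_le_ballMaximal (z := z) (ρ := ρ) hy)
    rw [setLAverage_eq, withDensity_apply _ measurableSet_ball,
      setLIntegral_withDensity_eq_setLIntegral_mul_non_measurable _ hσm _ measurableSet_ball
        (Filter.Eventually.of_forall fun y => (hσt y).lt_top)]
    simp only [Pi.mul_apply, ENNReal.mul_div_cancel (hσ0 _) (hσt _)]
    rfl
  have h1 : A ^ (q - 1) * V / W ≤
      ballMaximal (volume.withDensity w) (fun y => G y ^ (q - 1) / w y) x := by
    refine le_trans ?_ (laverage_le_ballMaximal hx)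
    rw [setLAverage_eq, withDensity_apply _ measurableSet_ball,
      setLIntegral_withDensity_eq_setLIntegral_mul_non_measurable _ hw _ measurableSet_ball
        (Filter.Eventually.of_forall fun y => (ht y).lt_top)]
    simp only [Pi.mul_apply, ENNReal.mul_div_cancel (h0 _) (ht _)]
    refine ENNReal.div_le_div_right ?_ _
    rw [hVdef, ← setLIntegral_const]
    exact setLIntegral_mono' measurableSet_ball fun y hy =>
      ENNReal.rpow_le_rpow (hAG y hy) hq1.le
  refine le_trans ?_ (mul_le_mul_right h1 C)
  rw [setLAverage_eq]
  have h2 : (∫⁻ y in B, g y) = A * S := by rw [hAdef, ENNReal.div_mul_cancel hS0 hSt]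
  rw [h2, ENNReal.div_rpow_of_nonneg _ _ hq1.le, ENNReal.mul_rpow_of_nonneg _ _ hq1.le]
  have hVq0 : V ^ (q - 1) ≠ 0 := (ENNReal.rpow_pos (pos_iff_ne_zero.2 hV0) hVt).ne'
  have hVqt : V ^ (q - 1) ≠ ⊤ := ENNReal.rpow_ne_top_of_nonneg hq1.le hVt
  rw [ENNReal.div_le_iff hVq0 hVqt, ← ENNReal.mul_le_mul_iff_left hW0 hWt]
  calc A ^ (q - 1) * S ^ (q - 1) * W = A ^ (q - 1) * (W * S ^ (q - 1)) := by ring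
    _ ≤ A ^ (q - 1) * (C * V ^ q) := by gcongr
    _ = A ^ (q - 1) * (C * (V * V ^ (q - 1))) := by
        have : V ^ q = V * V ^ (q - 1) := by
          conv_lhs => rw [show q = 1 + (q - 1) by ring]
          rw [ENNReal.rpow_add _ _ hV0 hVt, ENNReal.rpow_one]
        rw [this]
    _ = C * (A ^ (q - 1) * V / W * W) * V ^ (q - 1) := by
        rw [ENNReal.div_mul_cancel hW0 hWt]; ring
    _ = _ := by ring

/-- Muckenhoupt's theorem, for weights that are positive and finite everywhere. -/
theorem exists_lintegral_ballMaximal_rpow_mul_le (hq : 1 < q) (hC : C ≠ ⊤) (hw : Measurable w)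
    (h0 : ∀ y, w y ≠ 0) (ht : ∀ y, w y ≠ ⊤)
    (hA : ∀ (z : EuclideanSpace ℝ (Fin n)) (ρ : ℝ), 0 < ρ → (∫⁻ y in ball z ρ, w y) *
      (∫⁻ y in ball z ρ, w y ^ (1 - q / (q - 1))) ^ (q - 1) ≤ C * volume (ball z ρ) ^ q) :
    ∃ C' : ℝ≥0∞, C' ≠ ⊤ ∧ ∀ g : EuclideanSpace ℝ (Fin n) → ℝ≥0∞, AEMeasurable g volume →
      ∫⁻ x, ballMaximal volume g x ^ q ∂(volume.withDensity w) ≤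
        C' * ∫⁻ x, g x ^ q ∂(volume.withDensity w) := by
  have hq1 : 0 < q - 1 := by linarith
  have hq0 : 0 < q := by linarith
  have hp : 1 < q / (q - 1) := by rw [one_lt_div hq1]; linarith
  have hdbl := fun z (ρ : ℝ) (hρ : 0 < ρ) => muckenhoupt_doubling hq hw h0 ht hA z hρ
  set D := C * ENNReal.ofReal (5 ^ n) ^ q
  have hD : D ≠ ⊤ := ENNReal.mul_ne_top hC
    (ENNReal.rpow_ne_top_of_nonneg (by linarith) ENNReal.ofReal_ne_top)
  set σ : EuclideanSpace ℝ (Fin n) → ℝ≥0∞ := fun y => w y ^ (1 - q / (q - 1)) with hσ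
  have hσm : Measurable σ := hw.pow_const _
  have hσ0 : ∀ y, σ y ≠ 0 := fun y => (ENNReal.rpow_pos (pos_iff_ne_zero.2 (h0 y)) (ht y)).ne'
  have hσt : ∀ y, σ y ≠ ⊤ := fun y => ENNReal.rpow_ne_top_of_ne_zero (h0 y) (ht y)
  obtain ⟨C₁, hC₁, hb₁⟩ := exists_lintegral_ballMaximal_rpow_le hD
    (fun z ρ hρ => (hdbl z ρ hρ).1) hp
  obtain ⟨C₂, hC₂, hb₂⟩ := exists_lintegral_ballMaximal_rpow_le
    (ENNReal.rpow_ne_top_of_nonneg (by positivity) hD) (fun z ρ hρ => (hdbl z ρ hρ).2) hq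
  refine ⟨C ^ (q / (q - 1)) * (C₁ * C₂), ENNReal.mul_ne_top
    (ENNReal.rpow_ne_top_of_nonneg (by positivity) hC) (ENNReal.mul_ne_top hC₁ hC₂),
    fun g hg => ?_⟩
  set G := ballMaximal (volume.withDensity σ) (fun y => g y / σ y) with hG
  have hGm : Measurable G := measurable_ballMaximal _
  have hhm : Measurable fun y => G y ^ (q - 1) / w y := (hGm.pow_const _).div hw
  have hMm := measurable_ballMaximal (μ := volume.withDensity w) fun y => G y ^ (q - 1) / w y
  -- The pointwise bound is raised to the power q' = q/(q-1). The outer operator is then bounded on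
  -- L^{q'}(w), the inner one on L^q(σ), and (G^(q-1)/w)^(q') w = G^q σ links the two.
  calc ∫⁻ x, ballMaximal volume g x ^ q ∂(volume.withDensity w)
      ≤ ∫⁻ x, C ^ (q / (q - 1)) * ballMaximal (volume.withDensity w)
          (fun y => G y ^ (q - 1) / w y) x ^ (q / (q - 1)) ∂(volume.withDensity w) := by
        refine lintegral_mono fun x => ?_
        have h1 := ENNReal.rpow_le_rpow (ballMaximal_rpow_le hq hC hw h0 ht hA g x)
          (by positivity : 0 ≤ q / (q - 1))
        rwa [← ENNReal.rpow_mul, mul_div_cancel₀ _ hq1.ne',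
          ENNReal.mul_rpow_of_nonneg _ _ (by positivity)] at h1
    _ = C ^ (q / (q - 1)) * ∫⁻ x, ballMaximal (volume.withDensity w)
          (fun y => G y ^ (q - 1) / w y) x ^ (q / (q - 1)) ∂(volume.withDensity w) :=
        lintegral_const_mul _ (hMm.pow_const _)
    _ ≤ C ^ (q / (q - 1)) * (C₁ * ∫⁻ x, (G x ^ (q - 1) / w x) ^ (q / (q - 1))
          ∂(volume.withDensity w)) := by
        gcongr
        exact hb₁ _ hhm.aemeasurable
    _ = C ^ (q / (q - 1)) * (C₁ * ∫⁻ x, G x ^ q ∂(volume.withDensity σ)) := by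
        rw [lintegral_withDensity_eq_lintegral_mul _ hw (hhm.pow_const _),
          lintegral_withDensity_eq_lintegral_mul _ hσm (hGm.pow_const _)]
        congr 2
        refine lintegral_congr fun x => ?_
        simp only [Pi.mul_apply, hσ]
        rw [ENNReal.div_rpow_of_nonneg _ _ (by positivity), ← ENNReal.rpow_mul,
          mul_div_cancel₀ _ hq1.ne', ENNReal.rpow_sub _ _ (h0 x) (ht x), ENNReal.rpow_one]
        simp only [div_eq_mul_inv]
        ring
    _ ≤ C ^ (q / (q - 1)) * (C₁ * (C₂ * ∫⁻ x, (g x / σ x) ^ q ∂(volume.withDensity σ))) := by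
        gcongr
        refine hb₂ _ ?_
        exact (hg.div hσm.aemeasurable).mono_ac (withDensity_absolutelyContinuous _ _)
    _ = _ := by
        have hgσ : AEMeasurable (fun x => (g x / σ x) ^ q) volume :=
          (hg.div hσm.aemeasurable).pow_const _
        rw [lintegral_withDensity_eq_lintegral_mul₀ hσm.aemeasurable hgσ,
          lintegral_withDensity_eq_lintegral_mul₀ hw.aemeasurable (hg.pow_const _)]
        have : ∀ x, (σ * fun x => (g x / σ x) ^ q) x = (w * fun x => g x ^ q) x := by
          intro x
          have h1 : σ x * (σ x ^ q)⁻¹ = w x := by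
            rw [← div_eq_mul_inv]
            conv_lhs => enter [1]; rw [← ENNReal.rpow_one (σ x)]
            rw [← ENNReal.rpow_sub _ _ (hσ0 x) (hσt x)]
            simp only [hσ]
            rw [← ENNReal.rpow_mul, show (1 - q / (q - 1)) * (1 - q) = 1 by
              field_simp; ring, ENNReal.rpow_one]
          simp only [Pi.mul_apply]
          rw [ENNReal.div_rpow_of_nonneg _ _ hq0.le, div_eq_mul_inv, mul_left_comm, h1, mul_comm]
        simp_rw [this]
        ring

/-- If w vanishes on a set of positive measure, then w^(1-q') = ∞ there, so its average over every
large ball is infinite and A_q forces w = 0 almost everywhere on that ball. -/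
theorem IsMuckenhouptWeight.withDensity_eq_zero_or {w : EuclideanSpace ℝ (Fin n) → ℝ} (hq : 1 < q)
    (h : IsMuckenhouptWeight q w) :
    (volume.withDensity fun x => ENNReal.ofReal (w x)) = 0 ∨ ∀ᵐ x, 0 < w x := by
  obtain ⟨C, hC⟩ := h.bound
  have hq1 : 0 < q - 1 := by linarith
  rw [or_iff_not_imp_right]
  intro hne
  have hZ : volume {x | ¬ 0 < w x} ≠ 0 := by rwa [ae_iff] at hne
  have hlim : volume {x | ¬ 0 < w x} = ⨆ R : ℕ, volume ({x | ¬ 0 < w x} ∩ ball 0 R) := by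
    rw [← Monotone.measure_iUnion, ← Set.inter_iUnion, iUnion_ball_nat, Set.inter_univ]
    intro R S hRS
    exact Set.inter_subset_inter_right _ (ball_subset_ball (by exact_mod_cast hRS))
  have hex : ∃ R : ℕ, volume ({x | ¬ 0 < w x} ∩ ball 0 R) ≠ 0 := by
    by_contra! hall
    simp [hall] at hlim
    exact hZ (by simpa using hlim)
  obtain ⟨R₀, hR₀⟩ := hex
  have hzero : ∀ R : ℕ, R₀ ≤ R → ∫⁻ y in ball (0 : EuclideanSpace ℝ (Fin n)) R, ENNReal.ofReal (w y) = 0 := by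
    intro R hR
    rcases Nat.eq_zero_or_pos R with rfl | hRpos
    · simp
    have hRpos' : (0 : ℝ) < R := by exact_mod_cast hRpos
    have hV0 : volume (ball (0 : EuclideanSpace ℝ (Fin n)) R) ≠ 0 := (measure_ball_pos _ _ hRpos').ne'
    have hVt : volume (ball (0 : EuclideanSpace ℝ (Fin n)) R) ≠ ⊤ := measure_ball_lt_top.ne
    have hσ : ∫⁻ y in ball (0 : EuclideanSpace ℝ (Fin n)) R, ENNReal.ofReal (w y) ^ (1 - q / (q - 1)) = ⊤ := by
      have hwm : AEMeasurable w volume := h.locallyIntegrable.aestronglyMeasurable.aemeasurable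
      by_contra hfin
      have h1 := ae_lt_top' (hwm.ennreal_ofReal.pow_const _).restrict hfin
      rw [ae_restrict_iff' measurableSet_ball, ae_iff] at h1
      refine hR₀ (measure_mono_null ?_ h1)
      rintro x ⟨hx, hxR⟩
      simp only [Set.mem_ofPred_eq, not_forall, not_lt, top_le_iff]
      refine ⟨ball_subset_ball (by exact_mod_cast hR) hxR, ?_⟩
      rw [ENNReal.ofReal_of_nonpos (not_lt.1 hx), ENNReal.zero_rpow_of_neg]
      rw [sub_neg, one_lt_div hq1]
      linarith
    have h2 := hC 0 R hRpos'
    rw [setLAverage_eq, setLAverage_eq, hσ, ENNReal.top_div_of_ne_top hVt,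
      ENNReal.top_rpow_of_pos hq1] at h2
    by_contra hne
    rw [ENNReal.mul_top (ENNReal.div_ne_zero.2 ⟨hne, hVt⟩)] at h2
    exact absurd h2 (by simp)
  refine Measure.measure_univ_eq_zero.1 ?_
  rw [← iUnion_ball_nat (0 : EuclideanSpace ℝ (Fin n))]
  refine measure_iUnion_null fun R => ?_
  refine measure_mono_null (ball_subset_ball (by exact_mod_cast le_max_left R R₀))
    (t := ball (0 : EuclideanSpace ℝ (Fin n)) (max R R₀ : ℕ)) ?_
  rw [withDensity_apply _ measurableSet_ball]
  exact hzero _ (le_max_right _ _)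

/-- Muckenhoupt's theorem. -/
theorem IsMuckenhouptWeight.exists_lintegral_ballMaximal_le {w : EuclideanSpace ℝ (Fin n) → ℝ} (hq : 1 < q)
    (h : IsMuckenhouptWeight q w) (hpos : ∀ᵐ x, 0 < w x) :
    ∃ C' : ℝ≥0∞, C' ≠ ⊤ ∧ ∀ g : EuclideanSpace ℝ (Fin n) → ℝ≥0∞, AEMeasurable g volume →
      ∫⁻ x, ballMaximal volume g x ^ q ∂(volume.withDensity fun x => ENNReal.ofReal (w x)) ≤
        C' * ∫⁻ x, g x ^ q ∂(volume.withDensity fun x => ENNReal.ofReal (w x)) := by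
  have hq1 : 0 < q - 1 := by linarith
  obtain ⟨C, hC⟩ := h.bound
  have hwm : AEMeasurable w volume := h.locallyIntegrable.aestronglyMeasurable.aemeasurable
  -- A measurable, everywhere positive version of w, as the preceding theorem requires.
  set u : EuclideanSpace ℝ (Fin n) → ℝ := fun x => if 0 < hwm.mk w x then hwm.mk w x else 1
  have hu : Measurable u :=
    Measurable.ite (measurableSet_lt measurable_const hwm.measurable_mk) hwm.measurable_mk
      measurable_const
  have hupos : ∀ x, 0 < u x := by
    intro x
    simp only [u]
    split_ifs with hx
    exacts [hx, one_pos]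
  have huw : (fun x => ENNReal.ofReal (w x)) =ᵐ[volume] fun x => ENNReal.ofReal (u x) := by
    filter_upwards [hpos, hwm.ae_eq_mk] with x hx hx'
    simp only [u]
    rw [if_pos (hx' ▸ hx), hx']
  rw [withDensity_congr_ae huw]
  refine exists_lintegral_ballMaximal_rpow_mul_le (C := C) hq ENNReal.coe_ne_top hu.ennreal_ofReal
    (fun y => (ENNReal.ofReal_pos.2 (hupos y)).ne') (fun y => ENNReal.ofReal_ne_top) ?_
  intro z ρ hρ
  have hV0 : volume (ball z ρ) ≠ 0 := (measure_ball_pos _ _ hρ).ne'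
  have hVt : volume (ball z ρ) ≠ ⊤ := measure_ball_lt_top.ne
  have hVq0 : volume (ball z ρ) ^ (q - 1) ≠ 0 :=
    (ENNReal.rpow_pos (pos_iff_ne_zero.2 hV0) hVt).ne'
  have hVqt : volume (ball z ρ) ^ (q - 1) ≠ ⊤ := ENNReal.rpow_ne_top_of_nonneg hq1.le hVt
  have h1 := hC z ρ hρ
  have huw' : (fun x => ENNReal.ofReal (w x) ^ (1 - q / (q - 1))) =ᵐ[volume]
      fun x => ENNReal.ofReal (u x) ^ (1 - q / (q - 1)) := by
    filter_upwards [huw] with x hx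
    rw [hx]
  rw [setLAverage_eq, setLAverage_eq, lintegral_congr_ae (ae_restrict_of_ae huw),
    lintegral_congr_ae (ae_restrict_of_ae huw'), ENNReal.div_rpow_of_nonneg _ _ hq1.le] at h1
  have h2 : volume (ball z ρ) ^ q = volume (ball z ρ) * volume (ball z ρ) ^ (q - 1) := by
    conv_lhs => rw [show q = 1 + (q - 1) by ring]
    rw [ENNReal.rpow_add _ _ hV0 hVt, ENNReal.rpow_one]
  rw [h2]
  set V := volume (ball z ρ)
  set a := ∫⁻ y in ball z ρ, ENNReal.ofReal (u y)
  set b := (∫⁻ y in ball z ρ, ENNReal.ofReal (u y) ^ (1 - q / (q - 1))) ^ (q - 1)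
  calc a * b = (a / V * V) * (b / V ^ (q - 1) * V ^ (q - 1)) := by
        rw [ENNReal.div_mul_cancel hV0 hVt, ENNReal.div_mul_cancel hVq0 hVqt]
    _ = (a / V * (b / V ^ (q - 1))) * (V * V ^ (q - 1)) := by ring
    _ ≤ _ := by gcongr

end Muckenhoupt

end

/-! ### Convolution: maximal control, Young's inequality, weighted bounds -/

noncomputable section

section ConvolutionBounds

variable {n : ℕ}

theorem aemeasurable_comp_sub_left {β : Type*} [MeasurableSpace β]
    {F : EuclideanSpace ℝ (Fin n) → β} (hF : AEMeasurable F volume)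
    (x : EuclideanSpace ℝ (Fin n)) : AEMeasurable (fun y => F (x - y)) volume :=
  hF.comp_quasiMeasurePreserving (Measure.measurePreserving_sub_left volume x).quasiMeasurePreserving

/-- Only the term of the least k with u < 2^k is needed: minimality gives 2^k ≤ 2(1 + u). The right
side is a superposition of indicators of balls, ready for the maximal function. -/
theorem one_add_rpow_inv_le_tsum {u : ℝ} (hu : 0 ≤ u) (N : ℕ) :
    (ENNReal.ofReal ((1 + u) ^ N))⁻¹ ≤
      2 ^ N * ∑' k : ℕ, ((2 : ℝ≥0∞) ^ N)⁻¹ ^ k * {v : ℝ | v < 2 ^ k}.indicator 1 u := by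
  have hex : ∃ k : ℕ, u < 2 ^ k := pow_unbounded_of_one_lt u (by norm_num)
  classical
  set k := Nat.find hex
  have hk : u < 2 ^ k := Nat.find_spec hex
  have h1 : ((2 : ℝ≥0∞) ^ N)⁻¹ ^ k ≤
      ∑' k : ℕ, ((2 : ℝ≥0∞) ^ N)⁻¹ ^ k * {v : ℝ | v < 2 ^ k}.indicator 1 u := by
    refine le_trans (le_of_eq ?_) (ENNReal.le_tsum k)
    rw [Set.indicator_of_mem (by exact hk)]
    simp
  refine le_trans ?_ (mul_le_mul_right h1 _)
  have h2 : (2 : ℝ) ^ k ≤ 2 * (1 + u) := by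
    rcases Nat.eq_zero_or_pos k with h0 | hpos
    · rw [h0]; linarith
    · have := Nat.find_min hex (Nat.sub_lt hpos one_pos)
      have h3 : (2 : ℝ) ^ k = 2 * 2 ^ (k - 1) := by
        rw [← pow_succ', Nat.sub_add_cancel hpos]
      rw [h3]
      have h4 := not_lt.1 this
      linarith
  have h3 : (2 : ℝ≥0∞) ^ k ≤ 2 * ENNReal.ofReal (1 + u) := by
    have := ENNReal.ofReal_le_ofReal h2
    rwa [ENNReal.ofReal_mul (by norm_num), ENNReal.ofReal_pow (by norm_num),
      ENNReal.ofReal_ofNat] at this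
  rw [← ENNReal.inv_pow, ← pow_mul, mul_comm N k, pow_mul, ENNReal.ofReal_pow (by linarith)]
  calc (ENNReal.ofReal (1 + u) ^ N)⁻¹
      = 2 ^ N * ((2 * ENNReal.ofReal (1 + u)) ^ N)⁻¹ := by
        rw [mul_pow, ENNReal.mul_inv (by simp) (by simp), ← mul_assoc,
          ENNReal.mul_inv_cancel (by simp) (by finiteness), one_mul]
    _ ≤ 2 ^ N * ((2 ^ k) ^ N)⁻¹ := by gcongr

/-- A radially decreasing average is bounded by the maximal function. -/
theorem exists_lintegral_mul_decay_le (n : ℕ) : ∃ C : ℝ≥0∞, C ≠ ⊤ ∧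
    ∀ (F : EuclideanSpace ℝ (Fin n) → ℝ≥0∞), AEMeasurable F volume → ∀ t : ℝ, 0 < t → ∀ x,
      ∫⁻ y, (ENNReal.ofReal ((1 + t * ‖y‖) ^ (n + 1)))⁻¹ * F (x - y) ≤
        C * (ENNReal.ofReal t ^ n)⁻¹ * ballMaximal volume F x := by
  set v := volume (ball (0 : EuclideanSpace ℝ (Fin n)) 1)
  -- The k-th ball has volume of order 2^(nk) against the weight 2^(-(n+1)k); the final 2 is the sum
  -- of the series 2^(-k).
  refine ⟨2 ^ (n + 1) * (v * 2), by finiteness [(measure_ball_lt_top : v < ⊤).ne],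
    fun F hF t ht x => ?_⟩
  have hFx := aemeasurable_comp_sub_left hF x
  have hm : ∀ k : ℕ, MeasurableSet {y : EuclideanSpace ℝ (Fin n) | t * ‖y‖ < 2 ^ k} := fun k =>
    measurableSet_lt (by fun_prop) measurable_const
  have hset : ∀ k : ℕ, {y : EuclideanSpace ℝ (Fin n) | t * ‖y‖ < 2 ^ k} = ball 0 (2 ^ k / t) := by
    intro k
    ext y
    simp [lt_div_iff₀ ht, mul_comm]
  have hshell : ∀ k : ℕ, ∫⁻ y in {y : EuclideanSpace ℝ (Fin n) | t * ‖y‖ < 2 ^ k}, F (x - y) ≤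
      (2 ^ n) ^ k * ((ENNReal.ofReal t ^ n)⁻¹ * v * ballMaximal volume F x) := by
    intro k
    have hR : (0 : ℝ) < 2 ^ k / t := by positivity
    have e1 : ∫⁻ y in {y : EuclideanSpace ℝ (Fin n) | t * ‖y‖ < 2 ^ k}, F (x - y) =
        ∫⁻ y in ball x (2 ^ k / t), F y := by
      rw [← lintegral_indicator (hm k), ← lintegral_indicator measurableSet_ball,
        ← lintegral_sub_left_eq_self _ x]
      refine lintegral_congr fun y => ?_
      rw [hset]
      by_cases hy : ‖x - y‖ < 2 ^ k / t
      · rw [Set.indicator_of_mem (by simpa using hy), sub_sub_cancel,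
          Set.indicator_of_mem (by rwa [mem_ball, dist_comm, dist_eq_norm])]
      · rw [Set.indicator_of_notMem (by simpa using hy),
          Set.indicator_of_notMem (by rwa [mem_ball, dist_comm, dist_eq_norm])]
    rw [e1]
    have h1 := laverage_le_ballMaximal (μ := volume) (g := F) (mem_ball_self (x := x) hR)
    rw [setLAverage_eq, ENNReal.div_le_iff (measure_ball_pos _ _ hR).ne' measure_ball_lt_top.ne,
      Measure.addHaar_ball_of_pos _ _ hR, finrank_euclideanSpace_fin, div_pow,
      ENNReal.ofReal_div_of_pos (by positivity), ENNReal.ofReal_pow ht.le,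
      ENNReal.ofReal_pow (by positivity), ENNReal.ofReal_pow (by positivity), ENNReal.ofReal_ofNat,
      ← pow_mul, mul_comm k n, pow_mul] at h1
    refine h1.trans (le_of_eq ?_)
    rw [div_eq_mul_inv]
    ring
  calc ∫⁻ y, (ENNReal.ofReal ((1 + t * ‖y‖) ^ (n + 1)))⁻¹ * F (x - y)
      ≤ ∫⁻ y, 2 ^ (n + 1) * ∑' k : ℕ, ((2 : ℝ≥0∞) ^ (n + 1))⁻¹ ^ k *
          {y : EuclideanSpace ℝ (Fin n) | t * ‖y‖ < 2 ^ k}.indicator (fun y => F (x - y)) y := by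
        refine lintegral_mono fun y => ?_
        refine (mul_le_mul_left (one_add_rpow_inv_le_tsum (by positivity) (n + 1)) _).trans
          (le_of_eq ?_)
        rw [mul_assoc, ← ENNReal.tsum_mul_right]
        congr 1
        refine tsum_congr fun k => ?_
        by_cases hy : t * ‖y‖ < 2 ^ k
        · rw [Set.indicator_of_mem (by exact hy), Set.indicator_of_mem (by exact hy)]
          simp
        · rw [Set.indicator_of_notMem (by exact hy), Set.indicator_of_notMem (by exact hy)]
          simp
    _ = 2 ^ (n + 1) * ∑' k : ℕ, ((2 : ℝ≥0∞) ^ (n + 1))⁻¹ ^ k *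
          ∫⁻ y in {y : EuclideanSpace ℝ (Fin n) | t * ‖y‖ < 2 ^ k}, F (x - y) := by
        rw [lintegral_const_mul' _ _ (by finiteness), lintegral_tsum]
        · congr 1
          refine tsum_congr fun k => ?_
          rw [lintegral_const_mul' _ _ (by finiteness), lintegral_indicator (hm k)]
        · exact fun k => (hFx.indicator (hm k)).const_mul _
    _ ≤ 2 ^ (n + 1) * ∑' k : ℕ, (2 : ℝ≥0∞)⁻¹ ^ k *
          ((ENNReal.ofReal t ^ n)⁻¹ * v * ballMaximal volume F x) := by
        refine mul_le_mul' le_rfl (ENNReal.tsum_le_tsum fun k => ?_)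
        refine (mul_le_mul_right (hshell k) _).trans (le_of_eq ?_)
        rw [← mul_assoc, ← mul_pow, pow_succ' (2 : ℝ≥0∞) n,
          ENNReal.mul_inv (by simp) (by simp), mul_assoc (2 : ℝ≥0∞)⁻¹,
          ENNReal.inv_mul_cancel (by simp) (by finiteness), mul_one]
    _ = _ := by
        rw [ENNReal.tsum_mul_right, ENNReal.tsum_geometric, ENNReal.one_sub_inv_two, inv_inv]
        ring

theorem maximalFunction_eq {s : ℝ} (f : EuclideanSpace ℝ (Fin n) → ℂ)
    (x : EuclideanSpace ℝ (Fin n)) :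
    maximalFunction s f x = ballMaximal volume (fun y => ‖f y‖ₑ ^ s) x ^ (1 / s) := rfl

/-- A kernel with weighted `L^∞` and `L²` bounds is controlled by the maximal function `M_s`,
`1 ≤ s ≤ 2`. -/
theorem exists_lintegral_kernel_le (n : ℕ) : ∃ C : ℝ≥0∞, C ≠ ⊤ ∧
    ∀ s : ℝ, 1 ≤ s → s ≤ 2 → ∀ (A : ℝ≥0∞) (t : ℝ), 0 < t →
    ∀ K : EuclideanSpace ℝ (Fin n) → ℂ, AEStronglyMeasurable K volume →
      (∀ y, ‖K y‖ₑ * ENNReal.ofReal ((1 + t * ‖y‖) ^ (n + 1)) ≤ A * ENNReal.ofReal t) →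
      (∫⁻ y, (‖K y‖ₑ * ENNReal.ofReal ((1 + t * ‖y‖) ^ (n + 1))) ^ (2 : ℝ) ≤
        A ^ (2 : ℝ) * ENNReal.ofReal t) →
      ∀ f : EuclideanSpace ℝ (Fin n) → ℂ, AEStronglyMeasurable f volume → ∀ x,
        ∫⁻ y, ‖K y‖ₑ * ‖f (x - y)‖ₑ ≤
          C * A * ENNReal.ofReal t ^ (-(((n : ℝ) - 1) / s)) * maximalFunction s f x := by
  obtain ⟨C, hC, h⟩ := exists_lintegral_mul_decay_le n
  -- The bound C^(1/s) ≤ max C 1 for s ≥ 1 makes the constant independent of s.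
  refine ⟨max C 1, by finiteness, fun s hs1 hs2 A t ht K hK hsup hL2 f hf x => ?_⟩
  have hs0 : 0 < s := by linarith
  have hτ0 : ENNReal.ofReal t ≠ 0 := (ENNReal.ofReal_pos.2 ht).ne'
  have hτt : ENNReal.ofReal t ≠ ⊤ := ENNReal.ofReal_ne_top
  set τ := ENNReal.ofReal t
  set W : EuclideanSpace ℝ (Fin n) → ℝ≥0∞ := fun y => ENNReal.ofReal ((1 + t * ‖y‖) ^ (n + 1))
    with hW
  have hWm : Measurable W := by fun_prop
  have hW1 : ∀ y, 1 ≤ W y := fun y => by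
    rw [hW, ENNReal.one_le_ofReal]
    exact one_le_pow₀ (by have : 0 ≤ t * ‖y‖ := by positivity
                          linarith)
  have hW0 : ∀ y, W y ≠ 0 := fun y => (zero_lt_one.trans_le (hW1 y)).ne'
  have hWt : ∀ y, W y ≠ ⊤ := fun y => ENNReal.ofReal_ne_top
  have hfm : AEMeasurable (fun y => ‖f y‖ₑ ^ s) volume := hf.enorm.pow_const s
  have hM := h _ hfm t ht x
  set M := ballMaximal volume (fun y => ‖f y‖ₑ ^ s) x with hMdef
  have hfx := aemeasurable_comp_sub_left hf.enorm x
  have hsplit : ∀ y, ‖K y‖ₑ * ‖f (x - y)‖ₑ = (‖K y‖ₑ * W y) * ((W y)⁻¹ * ‖f (x - y)‖ₑ) := by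
    intro y
    rw [mul_assoc, ← mul_assoc (W y), ENNReal.mul_inv_cancel (hW0 y) (hWt y), one_mul]
  simp_rw [hsplit]
  have hWf : AEMeasurable (fun y => (W y)⁻¹ * ‖f (x - y)‖ₑ) volume := hWm.inv.aemeasurable.mul hfx
  have hKW : AEMeasurable (fun y => ‖K y‖ₑ * W y) volume := hK.enorm.mul hWm.aemeasurable
  have hdecay : ∫⁻ y, ((W y)⁻¹ * ‖f (x - y)‖ₑ) ^ s ≤ C * (τ ^ n)⁻¹ * M := by
    refine le_trans (lintegral_mono fun y => ?_) hM
    rw [ENNReal.mul_rpow_of_nonneg _ _ hs0.le]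
    gcongr
    calc (W y)⁻¹ ^ s ≤ (W y)⁻¹ ^ (1 : ℝ) :=
          ENNReal.rpow_le_rpow_of_exponent_ge (ENNReal.inv_le_one.2 (hW1 y)) hs1
      _ = (W y)⁻¹ := ENNReal.rpow_one _
  have hdecay' : (∫⁻ y, ((W y)⁻¹ * ‖f (x - y)‖ₑ) ^ s) ^ (1 / s) ≤
      max C 1 * τ ^ (-((n : ℝ) / s)) * maximalFunction s f x := by
    refine (ENNReal.rpow_le_rpow hdecay (by positivity)).trans ?_
    rw [ENNReal.mul_rpow_of_nonneg _ _ (by positivity), ENNReal.mul_rpow_of_nonneg _ _ (by positivity),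
      maximalFunction_eq]
    gcongr
    · calc C ^ (1 / s) ≤ (max C 1) ^ (1 / s) := by gcongr; exact le_max_left _ _
        _ ≤ (max C 1) ^ (1 : ℝ) := ENNReal.rpow_le_rpow_of_exponent_le (le_max_right _ _)
            (by rw [div_le_one hs0]; exact hs1)
        _ = max C 1 := ENNReal.rpow_one _
    · rw [← ENNReal.rpow_natCast, ← ENNReal.rpow_neg, ← ENNReal.rpow_mul]
      exact le_of_eq (by congr 1; ring)
  have hexp : τ ^ (1 / s) * τ ^ (-((n : ℝ) / s)) = τ ^ (-(((n : ℝ) - 1) / s)) := by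
    rw [← ENNReal.rpow_add _ _ hτ0 hτt]
    congr 1
    ring
  -- What remains is Hölder with ‖K W‖_{s'} ≤ A t^(1/s). For s = 1 this is the sup bound. For s > 1
  -- one has s' ≥ 2, and |K W|^(s') is bounded by (A t)^(s'-2) |K W|².
  suffices hmain : ∫⁻ y, (‖K y‖ₑ * W y) * ((W y)⁻¹ * ‖f (x - y)‖ₑ) ≤
      (A * τ ^ (1 / s)) * (∫⁻ y, ((W y)⁻¹ * ‖f (x - y)‖ₑ) ^ s) ^ (1 / s) by
    refine hmain.trans ((mul_le_mul_right hdecay' _).trans (le_of_eq ?_))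
    rw [← hexp]
    ring
  rcases hs1.eq_or_lt with rfl | hs1'
  · have : ∀ y, (‖K y‖ₑ * W y) * ((W y)⁻¹ * ‖f (x - y)‖ₑ) ≤
        A * τ * ((W y)⁻¹ * ‖f (x - y)‖ₑ) := fun y =>
      mul_le_mul' (hsup y) le_rfl
    refine (lintegral_mono this).trans (le_of_eq ?_)
    rw [lintegral_const_mul'' _ hWf]
    simp
  · set s' := s / (s - 1) with hs'
    have hconj : s'.HolderConjugate s := (Real.HolderConjugate.conjExponent hs1').symm
    have hs'2 : 2 ≤ s' := by
      rw [hs', le_div_iff₀ (by linarith)]; linarith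
    have hs'0 : 0 < s' := by linarith
    have hholder := ENNReal.lintegral_mul_le_Lp_mul_Lq volume hconj hKW hWf
    refine hholder.trans ?_
    gcongr
    have h1 : ∫⁻ y, (‖K y‖ₑ * W y) ^ s' ≤ (A * τ) ^ (s' - 2) * (A ^ (2 : ℝ) * τ) := by
      calc ∫⁻ y, (‖K y‖ₑ * W y) ^ s'
          ≤ ∫⁻ y, (A * τ) ^ (s' - 2) * (‖K y‖ₑ * W y) ^ (2 : ℝ) := by
            refine lintegral_mono fun y => ?_
            calc (‖K y‖ₑ * W y) ^ s' = (‖K y‖ₑ * W y) ^ (s' - 2) * (‖K y‖ₑ * W y) ^ (2 : ℝ) := by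
                  rw [← ENNReal.rpow_add_of_nonneg _ _ (by linarith) (by norm_num)]
                  congr 1
                  ring
              _ ≤ _ := by
                  exact mul_le_mul' (ENNReal.rpow_le_rpow (hsup y) (by linarith)) le_rfl
        _ = (A * τ) ^ (s' - 2) * ∫⁻ y, (‖K y‖ₑ * W y) ^ (2 : ℝ) := by
            rw [lintegral_const_mul'' _ (hKW.pow_const _)]
        _ ≤ _ := by gcongr
    refine (ENNReal.rpow_le_rpow h1 (by positivity)).trans (le_of_eq ?_)
    have h2 : (A * τ) ^ (s' - 2) * (A ^ (2 : ℝ) * τ) = A ^ s' * τ ^ (s' - 1) := by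
      have e1 : A ^ s' = A ^ (s' - 2) * A ^ (2 : ℝ) := by
        rw [← ENNReal.rpow_add_of_nonneg _ _ (by linarith) (by norm_num)]
        congr 1; ring
      have e2 : τ ^ (s' - 1) = τ ^ (s' - 2) * τ := by
        conv_rhs => enter [2]; rw [← ENNReal.rpow_one τ]
        rw [← ENNReal.rpow_add _ _ hτ0 hτt]
        congr 1; ring
      rw [ENNReal.mul_rpow_of_nonneg _ _ (by linarith), e1, e2]
      ring
    rw [h2, ENNReal.mul_rpow_of_nonneg _ _ (by positivity), ← ENNReal.rpow_mul, ← ENNReal.rpow_mul,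
      mul_one_div_cancel hs'0.ne', ENNReal.rpow_one]
    congr 2
    rw [hs']
    have : s - 1 ≠ 0 := by linarith
    field_simp
    ring

theorem enorm_conv_le (K f : EuclideanSpace ℝ (Fin n) → ℂ) (x : EuclideanSpace ℝ (Fin n)) :
    ‖conv K f x‖ₑ ≤ ∫⁻ y, ‖K y‖ₑ * ‖f (x - y)‖ₑ := by
  unfold conv convolution
  refine (enorm_integral_le_lintegral_enorm _).trans (lintegral_mono fun y => ?_)
  simp [enorm_mul]

/-- Boundedness of the positive operator `∫ |K(y)| |f(x - y)| dy` gives boundedness of the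
convolution. -/
theorem convolutionExistsAt_and_memLp_conv {μ : Measure (EuclideanSpace ℝ (Fin n))}
    (hμ : μ ≪ volume) {K f : EuclideanSpace ℝ (Fin n) → ℂ} (hK : AEStronglyMeasurable K volume)
    (hf : AEStronglyMeasurable f volume) {p : ℝ≥0∞} (hfp : MemLp f p μ) {B : ℝ}
    (hfin : ∀ᵐ x ∂μ, ∫⁻ y, ‖K y‖ₑ * ‖f (x - y)‖ₑ < ⊤)
    (hB : eLpNorm (conv K f) p μ ≤ ENNReal.ofReal B * eLpNorm f p μ) :
    (∀ᵐ x ∂μ, ConvolutionExistsAt K f x (ContinuousLinearMap.mul ℂ ℂ) volume) ∧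
    MemLp (conv K f) p μ ∧ eLpNorm (conv K f) p μ ≤ ENNReal.ofReal B * eLpNorm f p μ := by
  have hm : AEStronglyMeasurable (conv K f) volume :=
    (hK.convolution_integrand (ContinuousLinearMap.mul ℂ ℂ) hf).integral_prod_right'
  refine ⟨?_, ⟨hm.mono_ac hμ, hB.trans_lt (ENNReal.mul_lt_top ENNReal.ofReal_lt_top hfp.2)⟩, hB⟩
  filter_upwards [hfin] with x hx
  refine ⟨hK.convolution_integrand_snd _ hf x, ?_⟩
  refine lt_of_le_of_lt (lintegral_mono fun y => ?_) hx
  simp [enorm_mul]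

/-- Young's inequality `L¹ * L^p ⊆ L^p`. -/
theorem convBoundedOn_volume {K : EuclideanSpace ℝ (Fin n) → ℂ}
    (hK : AEStronglyMeasurable K volume) {B : ℝ} (hKB : ∫⁻ y, ‖K y‖ₑ ≤ ENNReal.ofReal B)
    {p : ℝ≥0∞} (hp : 1 ≤ p) : ConvBoundedOn K p volume B := by
  intro f hf
  have hKt : ∫⁻ y, ‖K y‖ₑ ≠ ⊤ := ne_top_of_le_ne_top ENNReal.ofReal_ne_top hKB
  rcases eq_or_ne p ⊤ with rfl | hpt
  · have hbd : ∀ x, ∫⁻ y, ‖K y‖ₑ * ‖f (x - y)‖ₑ ≤ ENNReal.ofReal B * eLpNorm f ⊤ volume := by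
      intro x
      have hae₀ : ∀ᵐ y, ‖f y‖ₑ ≤ eLpNorm f ⊤ volume := by
        rw [eLpNorm_exponent_top]; exact enorm_ae_le_eLpNormEssSup f volume
      have hae := (Measure.measurePreserving_sub_left volume x).quasiMeasurePreserving.ae hae₀
      calc ∫⁻ y, ‖K y‖ₑ * ‖f (x - y)‖ₑ ≤ ∫⁻ y, ‖K y‖ₑ * eLpNorm f ⊤ volume := by
            refine lintegral_mono_ae ?_
            filter_upwards [hae] with y hy
            gcongr
        _ = (∫⁻ y, ‖K y‖ₑ) * eLpNorm f ⊤ volume := lintegral_mul_const'' _ hK.enorm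
        _ ≤ _ := by gcongr
    refine convolutionExistsAt_and_memLp_conv Measure.AbsolutelyContinuous.rfl hK hf.1 hf ?_ ?_
    · exact Filter.Eventually.of_forall fun x =>
        (hbd x).trans_lt (ENNReal.mul_lt_top ENNReal.ofReal_lt_top hf.2)
    · rw [eLpNorm_exponent_top (f := conv K f)]
      exact eLpNormEssSup_le_of_ae_enorm_bound
        (Filter.Eventually.of_forall fun x => (enorm_conv_le K f x).trans (hbd x))
  · have hp0 : p ≠ 0 := (zero_lt_one.trans_le hp).ne'
    set P := p.toReal with hP
    have hP1 : 1 ≤ P := by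
      rw [hP, ← ENNReal.toReal_one]; exact ENNReal.toReal_mono hpt hp
    have hP0 : 0 < P := by linarith
    -- Hölder after splitting |K| = |K|^(1-1/P) |K|^(1/P); integrating in x and applying Tonelli
    -- then gives Young's inequality.
    have hholder : ∀ x, (∫⁻ y, ‖K y‖ₑ * ‖f (x - y)‖ₑ) ^ P ≤
        (∫⁻ y, ‖K y‖ₑ) ^ (P - 1) * ∫⁻ y, ‖K y‖ₑ * ‖f (x - y)‖ₑ ^ P := by
      intro x
      have h1 := ENNReal.lintegral_mul_norm_pow_le (μ := volume) (f := fun y => ‖K y‖ₑ)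
        (g := fun y => ‖K y‖ₑ * ‖f (x - y)‖ₑ ^ P) hK.enorm
        (hK.enorm.mul ((aemeasurable_comp_sub_left hf.1.enorm x).pow_const P))
        (p := 1 - 1 / P) (q := 1 / P) (by rw [sub_nonneg, div_le_one hP0]; exact hP1)
        (by positivity) (by ring)
      have h2 : ∀ y, ‖K y‖ₑ ^ (1 - 1 / P) * (‖K y‖ₑ * ‖f (x - y)‖ₑ ^ P) ^ (1 / P) =
          ‖K y‖ₑ * ‖f (x - y)‖ₑ := by
        intro y
        rw [ENNReal.mul_rpow_of_nonneg _ _ (by positivity), ← ENNReal.rpow_mul,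
          mul_one_div_cancel hP0.ne', ENNReal.rpow_one, ← mul_assoc,
          ← ENNReal.rpow_add_of_nonneg _ _ (by rw [sub_nonneg, div_le_one hP0]; exact hP1)
            (by positivity), sub_add_cancel, ENNReal.rpow_one]
      simp_rw [h2] at h1
      refine (ENNReal.rpow_le_rpow h1 hP0.le).trans (le_of_eq ?_)
      rw [ENNReal.mul_rpow_of_nonneg _ _ hP0.le, ← ENNReal.rpow_mul, ← ENNReal.rpow_mul,
        one_div_mul_cancel hP0.ne', ENNReal.rpow_one, sub_mul, one_mul, one_div_mul_cancel hP0.ne']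
    have hprod : AEMeasurable (Function.uncurry fun (x y : EuclideanSpace ℝ (Fin n)) =>
        ‖K y‖ₑ * ‖f (x - y)‖ₑ ^ P) (volume.prod volume) := by
      have h1 : AEMeasurable (fun q : EuclideanSpace ℝ (Fin n) × EuclideanSpace ℝ (Fin n) =>
          ‖K q.2‖ₑ) (volume.prod volume) := hK.enorm.comp_snd
      have h2 : AEMeasurable (fun q : EuclideanSpace ℝ (Fin n) × EuclideanSpace ℝ (Fin n) =>
          ‖f (q.1 - q.2)‖ₑ) (volume.prod volume) :=
        hf.1.enorm.comp_quasiMeasurePreserving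
          (quasiMeasurePreserving_sub_of_right_invariant volume volume)
      exact h1.mul (h2.pow_const P)
    have htot : ∫⁻ x, (∫⁻ y, ‖K y‖ₑ * ‖f (x - y)‖ₑ) ^ P ≤
        ENNReal.ofReal B ^ P * ∫⁻ x, ‖f x‖ₑ ^ P := by
      calc ∫⁻ x, (∫⁻ y, ‖K y‖ₑ * ‖f (x - y)‖ₑ) ^ P
          ≤ ∫⁻ x, (∫⁻ y, ‖K y‖ₑ) ^ (P - 1) * ∫⁻ y, ‖K y‖ₑ * ‖f (x - y)‖ₑ ^ P :=
            lintegral_mono hholder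
        _ = (∫⁻ y, ‖K y‖ₑ) ^ (P - 1) * ∫⁻ x, ∫⁻ y, ‖K y‖ₑ * ‖f (x - y)‖ₑ ^ P :=
            lintegral_const_mul' _ _ (ENNReal.rpow_ne_top_of_nonneg (by linarith) hKt)
        _ = (∫⁻ y, ‖K y‖ₑ) ^ (P - 1) * ((∫⁻ y, ‖K y‖ₑ) * ∫⁻ x, ‖f x‖ₑ ^ P) := by
            rw [lintegral_lintegral_swap hprod, ← lintegral_mul_const'' _ hK.enorm]
            congr 1
            refine lintegral_congr fun y => ?_
            rw [lintegral_const_mul' _ _ (by finiteness),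
              lintegral_sub_right_eq_self (fun x => ‖f x‖ₑ ^ P) y]
        _ = (∫⁻ y, ‖K y‖ₑ) ^ P * ∫⁻ x, ‖f x‖ₑ ^ P := by
            rw [← mul_assoc]
            congr 1
            conv_lhs => enter [2]; rw [← ENNReal.rpow_one (∫⁻ y, ‖K y‖ₑ)]
            rw [← ENNReal.rpow_add_of_nonneg _ _ (by linarith) zero_le_one, sub_add_cancel]
        _ ≤ _ := by gcongr
    have hfP : ∫⁻ x, ‖f x‖ₑ ^ P < ⊤ :=
      lintegral_rpow_enorm_lt_top_of_eLpNorm_lt_top hp0 hpt hf.2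
    refine convolutionExistsAt_and_memLp_conv Measure.AbsolutelyContinuous.rfl hK hf.1 hf ?_ ?_
    · have hTm : AEMeasurable (fun x => ∫⁻ y, ‖K y‖ₑ * ‖f (x - y)‖ₑ) volume := by
        refine AEMeasurable.lintegral_prod_right' (f := fun q : EuclideanSpace ℝ (Fin n) ×
          EuclideanSpace ℝ (Fin n) => ‖K q.2‖ₑ * ‖f (q.1 - q.2)‖ₑ) ?_
        exact hK.enorm.comp_snd.mul (hf.1.enorm.comp_quasiMeasurePreserving
          (quasiMeasurePreserving_sub_of_right_invariant volume volume))
      have h1 := ae_lt_top' (hTm.pow_const P) (htot.trans_lt (ENNReal.mul_lt_top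
        (ENNReal.rpow_lt_top_of_nonneg hP0.le ENNReal.ofReal_ne_top) hfP)).ne
      filter_upwards [h1] with x hx
      by_contra hne
      rw [not_lt, top_le_iff] at hne
      rw [hne, ENNReal.top_rpow_of_pos hP0] at hx
      exact lt_irrefl _ hx
    · rw [eLpNorm_eq_lintegral_rpow_enorm_toReal hp0 hpt, eLpNorm_eq_lintegral_rpow_enorm_toReal hp0 hpt,
        ← hP]
      have h1 : ∫⁻ x, ‖conv K f x‖ₑ ^ P ≤ ENNReal.ofReal B ^ P * ∫⁻ x, ‖f x‖ₑ ^ P :=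
        (lintegral_mono fun x => ENNReal.rpow_le_rpow (enorm_conv_le K f x) hP0.le).trans htot
      refine (ENNReal.rpow_le_rpow h1 (by positivity)).trans (le_of_eq ?_)
      rw [ENNReal.mul_rpow_of_nonneg _ _ (by positivity), ← ENNReal.rpow_mul,
        mul_one_div_cancel hP0.ne', ENNReal.rpow_one]

/-- Tested on f = 1, the pointwise maximal bound becomes a bound for the L¹ norm of the kernel. -/
theorem maximalFunction_const_one_le {s : ℝ} (hs : 0 < s) (x : EuclideanSpace ℝ (Fin n)) :
    maximalFunction s (fun _ => (1 : ℂ)) x ≤ 1 := by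
  rw [maximalFunction_eq]
  refine (ENNReal.rpow_le_rpow (z := 1 / s) (ballMaximal_le (a := 1) fun z ρ _ => ?_)
    (by positivity)).trans (by simp)
  rw [setLAverage_eq]
  simp only [enorm_one, ENNReal.one_rpow, setLIntegral_const, one_mul]
  exact ENNReal.div_self_le_one

/-- Pointwise control by `M_s` gives weighted bounds for `A_{p/s}` weights, with a constant that
does not depend on the kernel. -/
theorem exists_convBoundedOn_withDensity {s p : ℝ} (hs : 0 < s) (hsp : s < p)
    {w : EuclideanSpace ℝ (Fin n) → ℝ} (hw : IsMuckenhouptWeight (p / s) w) :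
    ∃ C : ℝ, 0 < C ∧ ∀ (K : EuclideanSpace ℝ (Fin n) → ℂ) (B : ℝ), AEStronglyMeasurable K volume →
      (∀ f : EuclideanSpace ℝ (Fin n) → ℂ, AEStronglyMeasurable f volume → ∀ x,
        ∫⁻ y, ‖K y‖ₑ * ‖f (x - y)‖ₑ ≤ ENNReal.ofReal B * maximalFunction s f x) →
      ConvBoundedOn K (ENNReal.ofReal p)
        (volume.withDensity fun x => ENNReal.ofReal (w x)) (C * B) := by
  have hp0 : 0 < p := hs.trans hsp
  have hq : 1 < p / s := by rw [one_lt_div hs]; exact hsp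
  set μ := volume.withDensity fun x => ENNReal.ofReal (w x) with hμ
  have hwm : AEMeasurable (fun x => ENNReal.ofReal (w x)) volume :=
    hw.locallyIntegrable.aestronglyMeasurable.aemeasurable.ennreal_ofReal
  rcases hw.withDensity_eq_zero_or hq with h0 | hpos
  · refine ⟨1, one_pos, fun K B hK _ f hf => ?_⟩
    rw [← hμ] at h0
    rw [h0]
    simp
  obtain ⟨C', hC', hM⟩ := hw.exists_lintegral_ballMaximal_le hq hpos
  rw [← hμ] at hM
  -- Positivity of w transfers measurability of f from μ to Lebesgue measure, where the kernel bound
  -- is stated.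
  have hvol : volume ≪ μ := withDensity_absolutelyContinuous' hwm (by
    filter_upwards [hpos] with x hx using (ENNReal.ofReal_pos.2 hx).ne')
  have hμv : μ ≪ volume := withDensity_absolutelyContinuous _ _
  set D : ℝ≥0∞ := C' ^ (1 / p) + 1
  have hD : D ≠ ⊤ := by
    have := ENNReal.rpow_ne_top_of_nonneg (by positivity : 0 ≤ 1 / p) hC'
    finiteness
  refine ⟨D.toReal, ENNReal.toReal_pos (by simp [D]) hD, fun K B hK hb f hf => ?_⟩
  have hfv : AEStronglyMeasurable f volume := hf.1.mono_ac hvol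
  have hpp0 : ENNReal.ofReal p ≠ 0 := (ENNReal.ofReal_pos.2 hp0).ne'
  have hppt : ENNReal.ofReal p ≠ ⊤ := ENNReal.ofReal_ne_top
  have hfp := lintegral_rpow_enorm_lt_top_of_eLpNorm_lt_top hpp0 hppt hf.2
  rw [ENNReal.toReal_ofReal hp0.le] at hfp
  have hMs : ∫⁻ x, maximalFunction s f x ^ p ∂μ ≤ C' * ∫⁻ x, ‖f x‖ₑ ^ p ∂μ := by
    have h1 := hM (fun y => ‖f y‖ₑ ^ s) (hfv.enorm.pow_const s)
    simp_rw [← ENNReal.rpow_mul, mul_div_cancel₀ _ hs.ne'] at h1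
    refine le_trans (le_of_eq (lintegral_congr fun x => ?_)) h1
    rw [maximalFunction_eq, ← ENNReal.rpow_mul]
    congr 1
    ring
  have hmeas : Measurable (maximalFunction s f) := (measurable_ballMaximal _).pow_const _
  refine convolutionExistsAt_and_memLp_conv hμv hK hfv hf ?_ ?_
  · have h1 := ae_lt_top' (hmeas.pow_const p).aemeasurable
      (hMs.trans_lt (ENNReal.mul_lt_top hC'.lt_top hfp)).ne
    filter_upwards [h1] with x hx
    refine (hb f hfv x).trans_lt (ENNReal.mul_lt_top ENNReal.ofReal_lt_top ?_)
    by_contra hne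
    rw [not_lt, top_le_iff] at hne
    rw [hne, ENNReal.top_rpow_of_pos hp0] at hx
    exact lt_irrefl _ hx
  · rw [eLpNorm_eq_lintegral_rpow_enorm_toReal hpp0 hppt,
      eLpNorm_eq_lintegral_rpow_enorm_toReal hpp0 hppt, ENNReal.toReal_ofReal hp0.le]
    have h1 : ∫⁻ x, ‖conv K f x‖ₑ ^ p ∂μ ≤
        ENNReal.ofReal B ^ p * (C' * ∫⁻ x, ‖f x‖ₑ ^ p ∂μ) := by
      calc ∫⁻ x, ‖conv K f x‖ₑ ^ p ∂μ
          ≤ ∫⁻ x, ENNReal.ofReal B ^ p * maximalFunction s f x ^ p ∂μ := by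
            refine lintegral_mono fun x => ?_
            rw [← ENNReal.mul_rpow_of_nonneg _ _ hp0.le]
            exact ENNReal.rpow_le_rpow ((enorm_conv_le K f x).trans (hb f hfv x)) hp0.le
        _ = ENNReal.ofReal B ^ p * ∫⁻ x, maximalFunction s f x ^ p ∂μ :=
            lintegral_const_mul _ (hmeas.pow_const p)
        _ ≤ _ := by gcongr
    refine (ENNReal.rpow_le_rpow h1 (by positivity)).trans ?_
    rw [ENNReal.mul_rpow_of_nonneg _ _ (by positivity), ENNReal.mul_rpow_of_nonneg _ _ (by positivity),
      ← ENNReal.rpow_mul, mul_one_div_cancel hp0.ne', ENNReal.rpow_one, ← mul_assoc,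
      ENNReal.ofReal_mul ENNReal.toReal_nonneg, ENNReal.ofReal_toReal hD, mul_comm D]
    gcongr
    exact le_self_add

end ConvolutionBounds

end

/-! ### Kernel bounds from symbol bounds -/

noncomputable section

section FourierKernel

open scoped FourierTransform SchwartzMap LineDeriv

variable {n : ℕ}

theorem SchwartzMap.norm_fourierInv_iterate_lineDerivOp (g : 𝓢(EuclideanSpace ℝ (Fin n), ℂ))
    (v : EuclideanSpace ℝ (Fin n)) (N : ℕ) (x : EuclideanSpace ℝ (Fin n)) :
    ‖𝓕⁻ (∂^{fun _ : Fin N => v} g) x‖ = (2 * Real.pi * |inner ℝ x v|) ^ N * ‖𝓕⁻ g x‖ := by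
  rw [LineDeriv.iteratedLineDerivOp_const_eq_iter_lineDerivOp]
  induction N with
  | zero => simp
  | succ N ih =>
    rw [Function.iterate_succ_apply', SchwartzMap.fourierInv_lineDerivOp_eq]
    have : (fun y : EuclideanSpace ℝ (Fin n) => inner ℝ y v).HasTemperateGrowth := by fun_prop
    simp only [smul_apply, SchwartzMap.smulLeftCLM_apply_apply this, norm_smul, ih]
    simp only [norm_neg, norm_mul, Complex.norm_ofNat, Complex.norm_real, Real.norm_eq_abs,
      Complex.norm_I, abs_of_pos Real.pi_pos]
    ring

theorem SchwartzMap.norm_fourierInv_le (h : 𝓢(EuclideanSpace ℝ (Fin n), ℂ))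
    {S : Set (EuclideanSpace ℝ (Fin n))} (hS : volume S < ⊤) (hsupp : ∀ ξ ∉ S, h ξ = 0)
    {B : ℝ} (hB : ∀ ξ, ‖h ξ‖ ≤ B) (x : EuclideanSpace ℝ (Fin n)) :
    ‖𝓕⁻ h x‖ ≤ B * (volume S).toReal := by
  rw [SchwartzMap.fourierInv_coe, Real.fourierInv_eq',
    ← setIntegral_eq_integral_of_forall_compl_eq_zero (s := S) fun ξ hξ => by simp [hsupp ξ hξ]]
  refine norm_setIntegral_le_of_norm_le_const hS fun ξ _ => ?_
  rw [norm_smul, Complex.norm_exp_ofReal_mul_I, one_mul]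
  exact hB ξ

theorem SchwartzMap.integral_norm_sq_fourierInv_le (h : 𝓢(EuclideanSpace ℝ (Fin n), ℂ))
    {S : Set (EuclideanSpace ℝ (Fin n))} (hS : volume S < ⊤) (hsupp : ∀ ξ ∉ S, h ξ = 0)
    {B : ℝ} (hB : ∀ ξ, ‖h ξ‖ ≤ B) :
    ∫ x, ‖𝓕⁻ h x‖ ^ 2 ≤ B ^ 2 * (volume S).toReal := by
  rw [← SchwartzMap.integral_norm_sq_fourier (𝓕⁻ h), FourierTransform.fourier_fourierInv_eq,
    ← setIntegral_eq_integral_of_forall_compl_eq_zero (s := S) fun ξ hξ => by simp [hsupp ξ hξ]]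
  refine (Real.le_norm_self _).trans (norm_setIntegral_le_of_norm_le_const hS fun ξ _ => ?_)
  rw [norm_pow, norm_norm]
  exact pow_le_pow_left₀ (norm_nonneg _) (hB ξ) 2

theorem EuclideanSpace.norm_le_sum_abs (x : EuclideanSpace ℝ (Fin n)) :
    ‖x‖ ≤ ∑ i, |inner ℝ x (EuclideanSpace.single i (1 : ℝ))| := by
  have h1 : x = ∑ i, inner ℝ x (EuclideanSpace.single i (1 : ℝ)) •
      EuclideanSpace.single i (1 : ℝ) := by
    ext j
    simp [EuclideanSpace.inner_single_right, Pi.single_apply]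
  conv_lhs => rw [h1]
  refine (norm_sum_le _ _).trans (le_of_eq (Finset.sum_congr rfl fun i _ => ?_))
  rw [norm_smul, PiLp.norm_single, norm_one, mul_one, Real.norm_eq_abs]

/-- The inverse Fourier transform `(2π)^{-n} ∫ e^{i y·ξ} ψ(ξ) dξ`. -/
def angularKernel (ψ : EuclideanSpace ℝ (Fin n) → ℂ) (y : EuclideanSpace ℝ (Fin n)) : ℂ :=
  ((2 * Real.pi : ℝ) : ℂ)⁻¹ ^ n * ∫ ξ, Complex.exp (Complex.I * ((inner ℝ y ξ : ℝ) : ℂ)) * ψ ξ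

/-- The phase of `𝓕⁻` is e^{2πi x·ξ}, so the two normalizations differ by the dilation y = 2πx. -/
theorem angularKernel_eq (ψ : EuclideanSpace ℝ (Fin n) → ℂ) (y : EuclideanSpace ℝ (Fin n)) :
    angularKernel ψ y = ((2 * Real.pi : ℝ) : ℂ)⁻¹ ^ n * 𝓕⁻ ψ ((2 * Real.pi)⁻¹ • y) := by
  rw [angularKernel, Real.fourierInv_eq']
  congr 1
  refine integral_congr_ae (Filter.Eventually.of_forall fun ξ => ?_)
  simp only [smul_eq_mul]
  rw [inner_smul_right, mul_inv_cancel_left₀ (by positivity), real_inner_comm, mul_comm Complex.I]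

theorem norm_angularKernel_le (ψ : EuclideanSpace ℝ (Fin n) → ℂ) (y : EuclideanSpace ℝ (Fin n)) :
    ‖angularKernel ψ y‖ ≤ ‖𝓕⁻ ψ ((2 * Real.pi)⁻¹ • y)‖ := by
  rw [angularKernel_eq, norm_mul]
  refine mul_le_of_le_one_left (norm_nonneg _) ?_
  rw [norm_pow, norm_inv, Complex.norm_real, Real.norm_eq_abs, abs_of_pos (by positivity)]
  refine pow_le_one₀ (by positivity) (inv_le_one_of_one_le₀ ?_)
  linarith [Real.pi_gt_three]

theorem aestronglyMeasurable_angularKernel {ψ : EuclideanSpace ℝ (Fin n) → ℂ}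
    (hc : HasCompactSupport ψ) (hs : ContDiff ℝ ∞ ψ) :
    AEStronglyMeasurable (angularKernel ψ) volume := by
  have h1 : angularKernel ψ = fun y => ((2 * Real.pi : ℝ) : ℂ)⁻¹ ^ n *
      (𝓕⁻ (hc.toSchwartzMap hs)) ((2 * Real.pi)⁻¹ • y) := by
    funext y
    rw [angularKernel_eq, SchwartzMap.fourierInv_coe]
    rfl
  rw [h1]
  have h2 := (𝓕⁻ (hc.toSchwartzMap hs)).continuous
  exact (by fun_prop : Continuous _).aestronglyMeasurable

/-- A symbol of frequency width `t` is reproduced, up to powers of `t` and the weight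
`1 + t |x|`, by finitely many symbols with the same bounds and support. -/
theorem norm_fourierInv_mul_pow_le {ψ : EuclideanSpace ℝ (Fin n) → ℂ}
    (hc : HasCompactSupport ψ) (hs : ContDiff ℝ ∞ ψ) {B t : ℝ} (ht : 0 < t)
    (h0 : ∀ ξ, ‖ψ ξ‖ ≤ B) (hN : ∀ ξ, ‖iteratedFDeriv ℝ (n + 1) ψ ξ‖ ≤ B / t ^ (n + 1)) :
    ∃ h : Option (Fin n) → 𝓢(EuclideanSpace ℝ (Fin n), ℂ),
      (∀ a, (∀ ξ ∉ tsupport ψ, h a ξ = 0) ∧ ∀ ξ, ‖h a ξ‖ ≤ B) ∧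
      ∀ x, ‖𝓕⁻ ψ x‖ * (1 + t * (2 * Real.pi * ‖x‖)) ^ (n + 1) ≤
        (n + 1 : ℝ) ^ n * ∑ a, ‖𝓕⁻ (h a) x‖ := by
  set g := hc.toSchwartzMap hs
  have hg : (g : EuclideanSpace ℝ (Fin n) → ℂ) = ψ := rfl
  -- The symbols are ψ itself (`none`) and t^(n+1) ∂_i^(n+1) ψ (`some i`), whose inverse transforms
  -- carry the factors 1 and (2πt|x_i|)^(n+1).
  refine ⟨fun a => a.elim g fun i => (t ^ (n + 1) : ℝ) •
    ∂^{fun _ : Fin (n + 1) => EuclideanSpace.single i (1 : ℝ)} g, ?_, fun x => ?_⟩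
  · rintro (_ | i)
    · exact ⟨fun ξ hξ => image_eq_zero_of_notMem_tsupport hξ, h0⟩
    · simp only [Option.elim_some]
      refine ⟨fun ξ hξ => ?_, fun ξ => ?_⟩
      · have h1 := SchwartzMap.tsupport_iteratedLineDerivOp_subset
          (fun _ : Fin (n + 1) => EuclideanSpace.single i (1 : ℝ)) g
        rw [smul_apply, image_eq_zero_of_notMem_tsupport fun h => hξ (h1 h), smul_zero]
      · rw [smul_apply, SchwartzMap.iteratedLineDerivOp_eq_iteratedFDeriv, norm_smul,
          Real.norm_of_nonneg (by positivity), ← le_div_iff₀' (by positivity)]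
        refine ((iteratedFDeriv ℝ (n + 1) g ξ).le_opNorm _).trans ?_
        simpa [hg] using hN ξ
  · set b : Option (Fin n) → ℝ := fun a =>
      a.elim 1 fun i => t * (2 * Real.pi * |inner ℝ x (EuclideanSpace.single i (1 : ℝ))|) with hb
    have hb0 : ∀ a, 0 ≤ b a := by
      rintro (_ | i)
      · exact zero_le_one
      · simp only [hb, Option.elim_some]; positivity
    have hba : ∀ a : Option (Fin n), ‖𝓕⁻ (a.elim g fun i => (t ^ (n + 1) : ℝ) •
        ∂^{fun _ : Fin (n + 1) => EuclideanSpace.single i (1 : ℝ)} g) x‖ =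
        b a ^ (n + 1) * ‖𝓕⁻ ψ x‖ := by
      rintro (_ | i)
      · simp [hb, SchwartzMap.fourierInv_coe, hg]
      · simp only [hb, Option.elim_some, FourierTransform.fourierInv_smul, smul_apply, norm_smul]
        rw [SchwartzMap.norm_fourierInv_iterate_lineDerivOp, mul_pow t,
          Real.norm_of_nonneg (by positivity), SchwartzMap.fourierInv_coe, hg, ← mul_assoc]
    have hsum : 1 + t * (2 * Real.pi * ‖x‖) ≤ ∑ a, b a := by
      rw [Fintype.sum_option]
      simp only [hb, Option.elim_none, Option.elim_some, ← Finset.mul_sum]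
      gcongr
      exact EuclideanSpace.norm_le_sum_abs x
    -- Power mean inequality for n + 1 terms, the source of the factor (n+1)^n.
    have hpow := pow_sum_div_card_le_sum_pow (s := Finset.univ) (f := b) (fun a _ => hb0 a) n
    rw [div_le_iff₀ (by simp; positivity), Finset.card_univ, Fintype.card_option, Fintype.card_fin] at hpow
    simp_rw [hba, ← Finset.sum_mul]
    push_cast at hpow
    calc ‖𝓕⁻ ψ x‖ * (1 + t * (2 * Real.pi * ‖x‖)) ^ (n + 1)
        ≤ ‖𝓕⁻ ψ x‖ * ((∑ a, b a ^ (n + 1)) * (n + 1) ^ n) := by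
          gcongr
          exact (pow_le_pow_left₀ (by positivity) hsum _).trans hpow
      _ = _ := by ring

/-- Each reproducing symbol is bounded by B on a set of measure V t. The trivial estimate gives the
sup bound and Plancherel the L² bound; V ≥ 1 lets one power of V serve both. -/
theorem exists_angularKernel_bounds (n : ℕ) : ∃ C : ℝ, 0 < C ∧
    ∀ ψ : EuclideanSpace ℝ (Fin n) → ℂ, HasCompactSupport ψ → ContDiff ℝ ∞ ψ →
    ∀ B t V : ℝ, 0 < t → 1 ≤ V → (∀ ξ, ‖ψ ξ‖ ≤ B) →
      (∀ ξ, ‖iteratedFDeriv ℝ (n + 1) ψ ξ‖ ≤ B / t ^ (n + 1)) →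
      volume (tsupport ψ) ≤ ENNReal.ofReal (V * t) →
      (∀ y, ‖angularKernel ψ y‖ₑ * ENNReal.ofReal ((1 + t * ‖y‖) ^ (n + 1)) ≤
        ENNReal.ofReal (C * B * V) * ENNReal.ofReal t) ∧
      ∫⁻ y, (‖angularKernel ψ y‖ₑ * ENNReal.ofReal ((1 + t * ‖y‖) ^ (n + 1))) ^ (2 : ℝ) ≤
        ENNReal.ofReal (C * B * V) ^ (2 : ℝ) * ENNReal.ofReal t := by
  have h2π : (0 : ℝ) < 2 * Real.pi := by positivity
  set Z : ℝ := (2 * Real.pi) ^ n with hZ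
  have hZ1 : 1 ≤ Z := one_le_pow₀ (by linarith [Real.pi_gt_three])
  -- (n+1)^n from the power mean, n + 1 for the number of symbols, and Z from the change of
  -- variables y = 2πx in the L² norm.
  refine ⟨Z * (n + 1) ^ (n + 1), by positivity, fun ψ hc hs B t V ht hV h0 hN hvol => ?_⟩
  have hB : 0 ≤ B := (norm_nonneg _).trans (h0 0)
  obtain ⟨h, hh, hle⟩ := norm_fourierInv_mul_pow_le hc hs ht h0 hN
  have hSt : volume (tsupport ψ) < ⊤ := hvol.trans_lt ENNReal.ofReal_lt_top
  have hSV : (volume (tsupport ψ)).toReal ≤ V * t := ENNReal.toReal_le_of_le_ofReal (by positivity) hvol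
  have hpt : ∀ y, ‖angularKernel ψ y‖ * (1 + t * ‖y‖) ^ (n + 1) ≤
      (n + 1 : ℝ) ^ n * ∑ a, ‖𝓕⁻ (h a) ((2 * Real.pi)⁻¹ • y)‖ := by
    intro y
    refine le_trans ?_ (hle ((2 * Real.pi)⁻¹ • y))
    rw [norm_smul, norm_inv, Real.norm_of_nonneg h2π.le, mul_inv_cancel_left₀ h2π.ne']
    gcongr
    exact norm_angularKernel_le ψ y
  have heq : ∀ y, ‖angularKernel ψ y‖ₑ * ENNReal.ofReal ((1 + t * ‖y‖) ^ (n + 1)) =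
      ENNReal.ofReal (‖angularKernel ψ y‖ * (1 + t * ‖y‖) ^ (n + 1)) := fun y => by
    rw [ENNReal.ofReal_mul (norm_nonneg _), ofReal_norm]
  simp_rw [heq]
  constructor
  · intro y
    rw [← ENNReal.ofReal_mul (by positivity)]
    refine ENNReal.ofReal_le_ofReal ((hpt y).trans ?_)
    calc (n + 1 : ℝ) ^ n * ∑ a, ‖𝓕⁻ (h a) ((2 * Real.pi)⁻¹ • y)‖
        ≤ (n + 1 : ℝ) ^ n * ∑ a : Option (Fin n), B * (V * t) := by
          gcongr with a
          exact ((h a).norm_fourierInv_le hSt (hh a).1 (hh a).2 _).trans (by gcongr)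
      _ = 1 * (n + 1) ^ (n + 1) * B * V * t := by simp; ring
      _ ≤ _ := by gcongr
  · have hint : ∀ a, Integrable (fun x => ‖𝓕⁻ (h a) x‖ ^ 2) volume := fun a =>
      ((𝓕⁻ (h a)).memLp 2 volume).integrable_norm_pow (by norm_num)
    have hint' : ∀ a, Integrable (fun y => ‖𝓕⁻ (h a) ((2 * Real.pi)⁻¹ • y)‖ ^ 2) volume := fun a =>
      (hint a).comp_smul (inv_ne_zero h2π.ne')
    have hintS : Integrable (fun y => ((n + 1 : ℝ) ^ n) ^ 2 * ((n + 1) *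
        ∑ a, ‖𝓕⁻ (h a) ((2 * Real.pi)⁻¹ • y)‖ ^ 2)) volume :=
      ((integrable_finsetSum _ fun a _ => hint' a).const_mul _).const_mul _
    calc ∫⁻ y, ENNReal.ofReal (‖angularKernel ψ y‖ * (1 + t * ‖y‖) ^ (n + 1)) ^ (2 : ℝ)
        ≤ ∫⁻ y, ENNReal.ofReal (((n + 1 : ℝ) ^ n) ^ 2 * ((n + 1) *
            ∑ a, ‖𝓕⁻ (h a) ((2 * Real.pi)⁻¹ • y)‖ ^ 2)) := by
          refine lintegral_mono fun y => ?_
          rw [ENNReal.rpow_two, ← ENNReal.ofReal_pow (by positivity)]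
          refine ENNReal.ofReal_le_ofReal ((pow_le_pow_left₀ (by positivity) (hpt y) 2).trans ?_)
          rw [mul_pow]
          gcongr
          have := sq_sum_le_card_mul_sum_sq (s := (Finset.univ : Finset (Option (Fin n))))
            (f := fun a => ‖𝓕⁻ (h a) ((2 * Real.pi)⁻¹ • y)‖)
          simpa [Finset.card_univ] using this
      _ = ENNReal.ofReal (∫ y, ((n + 1 : ℝ) ^ n) ^ 2 * ((n + 1) *
            ∑ a, ‖𝓕⁻ (h a) ((2 * Real.pi)⁻¹ • y)‖ ^ 2)) :=
          (ofReal_integral_eq_lintegral_ofReal hintS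
            (Filter.Eventually.of_forall fun y => by positivity)).symm
      _ ≤ ENNReal.ofReal ((Z * (n + 1) ^ (n + 1) * B * V) ^ 2 * t) := by
          refine ENNReal.ofReal_le_ofReal ?_
          rw [integral_const_mul, integral_const_mul, integral_finsetSum _ fun a _ => hint' a]
          have hone : ∀ a, ∫ y, ‖𝓕⁻ (h a) ((2 * Real.pi)⁻¹ • y)‖ ^ 2 ≤ Z * (B ^ 2 * (V * t)) := by
            intro a
            rw [Measure.integral_comp_smul volume (fun x => ‖𝓕⁻ (h a) x‖ ^ 2),
              finrank_euclideanSpace_fin, inv_pow, inv_inv, abs_of_pos (by positivity), smul_eq_mul]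
            gcongr
            exact ((h a).integral_norm_sq_fourierInv_le hSt (hh a).1 (hh a).2).trans (by gcongr)
          calc ((n + 1 : ℝ) ^ n) ^ 2 * ((n + 1) *
                ∑ a, ∫ y, ‖𝓕⁻ (h a) ((2 * Real.pi)⁻¹ • y)‖ ^ 2)
              ≤ ((n + 1 : ℝ) ^ n) ^ 2 * ((n + 1) *
                ∑ a : Option (Fin n), Z * (B ^ 2 * (V * t))) := by
                gcongr with a
                exact hone a
            _ = (Z * 1) * (((n + 1 : ℝ) ^ (n + 1)) ^ 2 * B ^ 2 * (V * 1) * t) := by simp; ring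
            _ ≤ (Z * Z) * (((n + 1 : ℝ) ^ (n + 1)) ^ 2 * B ^ 2 * (V * V) * t) := by gcongr
            _ = _ := by ring
      _ = _ := by
          rw [ENNReal.rpow_two, ← ENNReal.ofReal_pow (by positivity), ENNReal.ofReal_mul (by positivity)]

end FourierKernel

end

/-! ### Localized symbols -/

noncomputable section

section Symbol

variable {n : ℕ} {ι : Type*} {Ω : Set (EuclideanSpace ℝ (Fin n))} {δ : ℝ}
  {m : EuclideanSpace ℝ (Fin n) → ℂ} {c : ι → EuclideanSpace ℝ (Fin n)} {r : ι → ℝ}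
  {χ : ι → EuclideanSpace ℝ (Fin n) → ℝ}

/-- The exponent δ - k can have either sign; the sum of both constants covers both monotonicities.
-/
theorem Real.rpow_le_mul_of_equiv {a b t x : ℝ} (ha : 0 < a) (ht : 0 < t) (hax : a * t ≤ x)
    (hxb : x ≤ b * t) (e : ℝ) : x ^ e ≤ (a ^ e + b ^ e) * t ^ e := by
  have hx : 0 < x := (mul_pos ha ht).trans_le hax
  have hb : 0 < b := pos_of_mul_pos_left (hx.trans_le hxb) ht.le
  have hae := Real.rpow_pos_of_pos ha e
  have hbe := Real.rpow_pos_of_pos hb e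
  have hte := Real.rpow_pos_of_pos ht e
  rcases le_total 0 e with he | he
  · calc x ^ e ≤ (b * t) ^ e := Real.rpow_le_rpow hx.le hxb he
      _ = b ^ e * t ^ e := Real.mul_rpow hb.le ht.le
      _ ≤ _ := by gcongr; linarith
  · calc x ^ e ≤ (a * t) ^ e := Real.rpow_le_rpow_of_nonpos (mul_pos ha ht) hax he
      _ = a ^ e * t ^ e := Real.mul_rpow ha.le ht.le
      _ ≤ _ := by gcongr; linarith

/-- The localized symbol `t ^ (-δ) m χ_l`. -/
def localSymbol (δ : ℝ) (m : EuclideanSpace ℝ (Fin n) → ℂ)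
    (χ : ι → EuclideanSpace ℝ (Fin n) → ℝ) (t : ℝ) (l : ι) (ξ : EuclideanSpace ℝ (Fin n)) : ℂ :=
  (((t ^ (-δ) : ℝ) : ℂ) * m ξ) * ((χ l ξ : ℝ) : ℂ)

theorem tsupport_localSymbol_subset (hχ : IsAdaptedPartition Ω c r χ) (t : ℝ) (l : ι) :
    tsupport (localSymbol δ m χ t l) ⊆ closedBall (c l) (r l) := by
  refine closure_minimal (fun ξ hξ => ?_) isClosed_closedBall
  refine ball_subset_closedBall (hχ.support_subset l fun h0 => hξ ?_)
  simp [localSymbol, h0]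

/-- Off its closed support the product is locally zero; the closed support lies in a closed Whitney
ball, hence in Ω, where m is smooth. -/
theorem contDiff_localSymbol (hΩ : IsOpen Ω) (hm : IsBochnerRieszSymbol Ω δ m)
    (hO : IsWhitneyCovering Ω c r) (hχ : IsAdaptedPartition Ω c r χ) (t : ℝ) (l : ι) :
    ContDiff ℝ ∞ (localSymbol δ m χ t l) := by
  refine contDiff_iff_contDiffAt.2 fun ξ => ?_
  by_cases hξ : ξ ∈ tsupport (localSymbol δ m χ t l)
  swap
  · exact contDiffAt_const.congr_of_eventuallyEq (notMem_tsupport_iff_eventuallyEq.1 hξ)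
  have hξΩ := hO.closedBall_subset l (tsupport_localSymbol_subset hχ t l hξ)
  have h1 : ContDiffAt ℝ ∞ m ξ := hm.contDiffOn.contDiffAt (hΩ.mem_nhds hξΩ)
  have h2 : ContDiffAt ℝ ∞ (fun ξ => ((χ l ξ : ℝ) : ℂ)) ξ :=
    Complex.ofRealCLM.contDiff.contDiffAt.comp ξ (hχ.contDiff l).contDiffAt
  exact (contDiffAt_const.mul h1).mul h2

theorem hasCompactSupport_localSymbol (hχ : IsAdaptedPartition Ω c r χ) (t : ℝ) (l : ι) :
    HasCompactSupport (localSymbol δ m χ t l) :=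
  (isCompact_closedBall _ _).of_isClosed_subset (isClosed_tsupport _)
    (tsupport_localSymbol_subset hχ t l)

/-- In each Leibniz term, t^(-δ) · t^(δ-i) · t^(-(k-i)) = t^(-k), since the distance to Γ is
comparable to t on the ball. -/
theorem exists_norm_iteratedFDeriv_localSymbol_le (hΩ : IsOpen Ω)
    (hm : IsBochnerRieszSymbol Ω δ m) (hO : IsWhitneyCovering Ω c r)
    (hχ : IsAdaptedPartition Ω c r χ) (k : ℕ) :
    ∃ C : ℝ, 0 ≤ C ∧ ∀ t : ℝ, 0 < t → ∀ l, t ≤ r l → r l < 2 * t → ∀ ξ,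
      ‖iteratedFDeriv ℝ k (localSymbol δ m χ t l) ξ‖ ≤ C / t ^ k := by
  obtain ⟨a, b, ha, hb, hab⟩ := hO.exists_infDist_equiv_closedBall
  choose Cm hCm using hm.deriv_bound
  choose Cχ hCχ using hχ.deriv_bound
  have hnn : ∀ i : ℕ, 0 ≤ a ^ (δ - i) + (2 * b) ^ (δ - i) := fun i => by positivity
  refine ⟨∑ i ∈ Finset.range (k + 1), (k.choose i : ℝ) *
    (|Cm i| * (a ^ (δ - i) + (2 * b) ^ (δ - i))) * |Cχ (k - i)|,
    Finset.sum_nonneg fun i _ => by have := hnn i; positivity, fun t ht l htl hlt ξ => ?_⟩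
  by_cases hξ : ξ ∈ tsupport (localSymbol δ m χ t l)
  swap
  · rw [Function.notMem_support.1 fun h => hξ (support_iteratedFDeriv_subset (𝕜 := ℝ) k h), norm_zero]
    exact div_nonneg (Finset.sum_nonneg fun i _ => by have := hnn i; positivity) (by positivity)
  have hξB := tsupport_localSymbol_subset hχ t l hξ
  have hξΩ := hO.closedBall_subset l hξB
  have hdist := hab l ξ hξB
  have hχc : ContDiff ℝ ∞ (fun ξ => ((χ l ξ : ℝ) : ℂ)) :=
    Complex.ofRealCLM.contDiff.comp (hχ.contDiff l)
  have hχn : ∀ i, ‖iteratedFDeriv ℝ i (fun ξ => ((χ l ξ : ℝ) : ℂ)) ξ‖ =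
      ‖iteratedFDeriv ℝ i (χ l) ξ‖ := fun i =>
    Complex.ofRealLI.norm_iteratedFDeriv_comp_left (n := ∞) (hχ.contDiff l).contDiffAt
      (mod_cast le_top)
  have hprod := norm_iteratedFDerivWithin_mul_le (n := k) hm.contDiffOn hχc.contDiffOn
    hΩ.uniqueDiffOn hξΩ (mod_cast le_top)
  have hmc : ContDiffAt ℝ k (fun ξ => m ξ * ((χ l ξ : ℝ) : ℂ)) ξ :=
    ((hm.contDiffOn.contDiffAt (hΩ.mem_nhds hξΩ)).mul hχc.contDiffAt).of_le (mod_cast le_top)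
  have hη : localSymbol δ m χ t l = fun ξ => ((t ^ (-δ) : ℝ) : ℂ) • (m ξ * ((χ l ξ : ℝ) : ℂ)) := by
    funext ξ
    simp [localSymbol, mul_assoc]
  rw [hη, iteratedFDeriv_const_smul_apply' hmc, norm_smul, Complex.norm_real,
    Real.norm_of_nonneg (by positivity), ← iteratedFDerivWithin_of_isOpen k hΩ hξΩ]
  calc t ^ (-δ) * ‖iteratedFDerivWithin ℝ k (fun ξ => m ξ * ((χ l ξ : ℝ) : ℂ)) Ω ξ‖
      ≤ t ^ (-δ) * ∑ i ∈ Finset.range (k + 1), (k.choose i : ℝ) *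
          ((|Cm i| * (a ^ (δ - i) + (2 * b) ^ (δ - i))) * t ^ (δ - i)) *
            (|Cχ (k - i)| / t ^ (k - i)) := by
        refine mul_le_mul_of_nonneg_left (hprod.trans (Finset.sum_le_sum fun i hi => ?_))
          (by positivity)
        rw [iteratedFDerivWithin_of_isOpen i hΩ hξΩ, iteratedFDerivWithin_of_isOpen (k - i) hΩ hξΩ,
          hχn]
        have h1 : ‖iteratedFDeriv ℝ i m ξ‖ ≤
            |Cm i| * (a ^ (δ - i) + (2 * b) ^ (δ - i)) * t ^ (δ - i) := by
          refine (hCm i ξ hξΩ).trans ?_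
          rw [mul_assoc]
          have h3 := Real.rpow_le_mul_of_equiv (b := 2 * b) ha ht
            (x := infDist ξ (closure Ω \ Ω)) (le_trans (by gcongr) hdist.1)
            (hdist.2.trans (by nlinarith)) (δ - i)
          have h4 : 0 ≤ infDist ξ (closure Ω \ Ω) ^ (δ - (i : ℝ)) :=
            Real.rpow_nonneg infDist_nonneg _
          gcongr
          exact le_abs_self _
        have h2 : ‖iteratedFDeriv ℝ (k - i) (χ l) ξ‖ ≤ |Cχ (k - i)| / t ^ (k - i) := by
          refine (hCχ (k - i) l ξ).trans ?_
          gcongr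
          exact le_abs_self _
        have := hnn i
        gcongr
    _ = _ := by
        rw [Finset.mul_sum, Finset.sum_div]
        refine Finset.sum_congr rfl fun i hi => ?_
        have hik : i ≤ k := Nat.lt_succ_iff.1 (Finset.mem_range.1 hi)
        have e1 : t ^ (-δ) * t ^ (δ - i) = (t ^ i)⁻¹ := by
          rw [← Real.rpow_add ht, show -δ + (δ - (i : ℝ)) = -(i : ℝ) by ring, Real.rpow_neg ht.le,
            Real.rpow_natCast]
        have e2 : (t ^ i)⁻¹ / t ^ (k - i) = 1 / t ^ k := by
          rw [inv_eq_one_div, div_div, ← pow_add, Nat.add_sub_cancel' hik]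
        calc _ = (t ^ (-δ) * t ^ (δ - i)) / t ^ (k - i) * ((k.choose i : ℝ) *
              (|Cm i| * (a ^ (δ - i) + (2 * b) ^ (δ - i))) * |Cχ (k - i)|) := by ring
          _ = _ := by rw [e1, e2]; ring

/-- Finiteness makes the `finsum` in `whitneyPiece` a genuine sum. -/
theorem IsWhitneyCovering.finite_scale (hO : IsWhitneyCovering Ω c r) (hn : 1 ≤ n)
    (hb : Bornology.IsBounded Ω) (hΩ : IsOpen Ω)
    (hΓ : IsLipschitzHypersurface (closure Ω \ Ω)) {t : ℝ} (ht : 0 < t) :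
    {l | t ≤ r l ∧ r l < 2 * t}.Finite := by
  obtain ⟨C, hC⟩ := hO.exists_card_mul_pow_le hn hb hΩ hΓ
  by_contra hinf
  obtain ⟨N, hN⟩ := exists_nat_gt (C / t ^ (n - 1))
  obtain ⟨I, hI, hcard⟩ := Set.Infinite.exists_subset_card_eq hinf N
  have h1 := hC t ht I fun l hl => hI hl
  rw [div_lt_iff₀ (by positivity), ← hcard] at hN
  linarith

/-- Uniform bounds for the sum of the localized symbols of scale `t`. -/
theorem exists_sum_localSymbol_bounds (hn : 1 ≤ n) (hΩ : IsOpen Ω)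
    (hΩb : Bornology.IsBounded Ω) (hΓ : IsLipschitzHypersurface (closure Ω \ Ω))
    (hm : IsBochnerRieszSymbol Ω δ m) (hO : IsWhitneyCovering Ω c r)
    (hχ : IsAdaptedPartition Ω c r χ) :
    ∃ B V : ℝ, 1 ≤ V ∧ ∀ t : ℝ, 0 < t → ∀ I : Finset ι, (∀ l ∈ I, t ≤ r l ∧ r l < 2 * t) →
      (∀ ξ, ‖∑ l ∈ I, localSymbol δ m χ t l ξ‖ ≤ B) ∧
      (∀ ξ, ‖iteratedFDeriv ℝ (n + 1) (fun ξ => ∑ l ∈ I, localSymbol δ m χ t l ξ) ξ‖ ≤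
        B / t ^ (n + 1)) ∧
      volume (tsupport fun ξ => ∑ l ∈ I, localSymbol δ m χ t l ξ) ≤ ENNReal.ofReal (V * t) := by
  classical
  obtain ⟨N, hN⟩ := hO.exists_card_le
  obtain ⟨C, hC⟩ := hO.exists_card_mul_pow_le hn hΩb hΩ hΓ
  choose D hD0 hD using exists_norm_iteratedFDeriv_localSymbol_le hΩ hm hO hχ
  set v := (volume (ball (0 : EuclideanSpace ℝ (Fin n)) 1)).toReal with hv
  have hsmooth := fun t l => contDiff_localSymbol hΩ hm hO hχ t l
  have key : ∀ k : ℕ, ∀ t : ℝ, 0 < t → ∀ I : Finset ι, (∀ l ∈ I, t ≤ r l ∧ r l < 2 * t) → ∀ ξ,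
      ‖iteratedFDeriv ℝ k (fun ξ => ∑ l ∈ I, localSymbol δ m χ t l ξ) ξ‖ ≤
        N 2 * D k / t ^ k := by
    intro k t ht I hI ξ
    rw [iteratedFDeriv_fun_sum_apply fun l _ => ((hsmooth t l).of_le (mod_cast le_top)).contDiffAt]
    -- Only balls with centre within 2t of ξ contribute, at most N 2 of them.
    have hfil : ∑ l ∈ I, iteratedFDeriv ℝ k (localSymbol δ m χ t l) ξ =
        ∑ l ∈ I.filter fun l => dist (c l) ξ < 2 * t,
          iteratedFDeriv ℝ k (localSymbol δ m χ t l) ξ := by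
      refine (Finset.sum_filter_of_ne fun l hl hne => ?_).symm
      have := tsupport_localSymbol_subset hχ t l (support_iteratedFDeriv_subset k hne)
      rw [mem_closedBall, dist_comm] at this
      exact this.trans_lt (hI l hl).2
    rw [hfil]
    refine (norm_sum_le_of_le _ fun l hl => hD k t ht l (hI l (Finset.mem_filter.1 hl).1).1
      (hI l (Finset.mem_filter.1 hl).1).2 ξ).trans ?_
    rw [Finset.sum_const, nsmul_eq_mul, mul_div_assoc]
    have h0 := hD0 k
    gcongr
    exact hN 2 two_pos t ht _ (fun l hl => (hI l (Finset.mem_filter.1 hl).1).1) ξ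
      fun l hl => (Finset.mem_filter.1 hl).2
  -- One B serves the orders 0 and n + 1. V comes from C t^(-(n-1)) balls of volume (2t)^n v, in
  -- total C 2^n v t.
  refine ⟨N 2 * D 0 + N 2 * D (n + 1), max 1 (C * 2 ^ n * v), le_max_left _ _,
    fun t ht I hI => ⟨fun ξ => ?_, fun ξ => ?_, ?_⟩⟩
  · have h1 := key 0 t ht I hI ξ
    have h2 := hD0 (n + 1)
    rw [norm_iteratedFDeriv_zero, pow_zero, div_one] at h1
    have : 0 ≤ (N 2 : ℝ) * D (n + 1) := by positivity
    linarith
  · refine (key (n + 1) t ht I hI ξ).trans ?_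
    have h2 := hD0 0
    have : 0 ≤ (N 2 : ℝ) * D 0 := by positivity
    gcongr
    linarith
  · have hsub : (tsupport fun ξ => ∑ l ∈ I, localSymbol δ m χ t l ξ) ⊆
        ⋃ l ∈ I, closedBall (c l) (2 * t) := by
      refine closure_minimal (fun ξ hξ => ?_)
        (I.finite_toSet.isClosed_biUnion fun l _ => isClosed_closedBall)
      obtain ⟨l, hl, hne⟩ := Finset.exists_ne_zero_of_sum_ne_zero hξ
      exact Set.mem_biUnion hl (closedBall_subset_closedBall (hI l hl).2.le
        (tsupport_localSymbol_subset hχ t l (subset_closure hne)))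
    refine (measure_mono hsub).trans ((measure_biUnion_finset_le I _).trans ?_)
    have hone : ∀ l, volume (closedBall (c l) (2 * t)) = ENNReal.ofReal ((2 * t) ^ n * v) := by
      intro l
      rw [Measure.addHaar_closedBall _ _ (by positivity), finrank_euclideanSpace_fin,
        ENNReal.ofReal_mul (by positivity), hv, ENNReal.ofReal_toReal measure_ball_lt_top.ne]
    simp_rw [hone]
    rw [Finset.sum_const, nsmul_eq_mul, ← ENNReal.ofReal_natCast, ← ENNReal.ofReal_mul (by positivity)]
    refine ENNReal.ofReal_le_ofReal ?_
    have h3 := hC t ht I hI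
    have hv0 : 0 ≤ v := ENNReal.toReal_nonneg
    have htn : t ^ n = t ^ (n - 1) * t := by rw [← pow_succ, Nat.sub_add_cancel hn]
    calc (I.card : ℝ) * ((2 * t) ^ n * v) = (I.card * t ^ (n - 1)) * (2 ^ n * v * t) := by
          rw [mul_pow, htn]; ring
      _ ≤ C * (2 ^ n * v * t) := by gcongr
      _ = (C * 2 ^ n * v) * t := by ring
      _ ≤ _ := by gcongr; exact le_max_right _ _

end Symbol

/-! ### The pieces as convolution operators -/

section Fubini

variable {n : ℕ}

theorem integrable_prod_phase {η f : EuclideanSpace ℝ (Fin n) → ℂ} (hη : Integrable η)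
    (hf : Integrable f) (x : EuclideanSpace ℝ (Fin n)) :
    Integrable (fun z : EuclideanSpace ℝ (Fin n) × EuclideanSpace ℝ (Fin n) =>
      Complex.exp (Complex.I * ((inner ℝ (x - z.2) z.1 : ℝ) : ℂ)) * (η z.1 * f z.2))
      (volume.prod volume) := by
  refine (hη.mul_prod hf).bdd_mul (c := 1) (Continuous.aestronglyMeasurable (by fun_prop)) ?_
  refine Filter.Eventually.of_forall fun z => ?_
  rw [mul_comm Complex.I, Complex.norm_exp_ofReal_mul_I]

theorem exp_mul_angularFourier_mul {η f : EuclideanSpace ℝ (Fin n) → ℂ}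
    (x ξ : EuclideanSpace ℝ (Fin n)) :
    Complex.exp (Complex.I * ((inner ℝ x ξ : ℝ) : ℂ)) * angularFourier f ξ * η ξ =
      ((2 * Real.pi : ℝ) : ℂ)⁻¹ ^ n * ∫ y,
        Complex.exp (Complex.I * ((inner ℝ (x - y) ξ : ℝ) : ℂ)) * (η ξ * f y) := by
  have h1 : ∀ y, Complex.exp (Complex.I * ((inner ℝ (x - y) ξ : ℝ) : ℂ)) * (η ξ * f y) =
      (Complex.exp (Complex.I * ((inner ℝ x ξ : ℝ) : ℂ)) * η ξ) *
        (Complex.exp (-(Complex.I * ((inner ℝ y ξ : ℝ) : ℂ))) * f y) := by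
    intro y
    rw [inner_sub_left, Complex.ofReal_sub, mul_sub, sub_eq_add_neg, Complex.exp_add]
    ring
  simp_rw [h1]
  rw [integral_const_mul, angularFourier]
  ring

theorem integrable_exp_mul_angularFourier_mul {η f : EuclideanSpace ℝ (Fin n) → ℂ}
    (hη : Integrable η) (hf : Integrable f) (x : EuclideanSpace ℝ (Fin n)) :
    Integrable fun ξ =>
      Complex.exp (Complex.I * ((inner ℝ x ξ : ℝ) : ℂ)) * angularFourier f ξ * η ξ := by
  simp_rw [exp_mul_angularFourier_mul]
  exact (integrable_prod_phase hη hf x).integral_prod_left.const_mul _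

/-- Fubini for e^{i(x-y)·ξ} η(ξ) f(y), which is absolutely integrable on the product; the ξ-integral
is the kernel at x - y. -/
theorem integral_exp_mul_angularFourier_mul {η f : EuclideanSpace ℝ (Fin n) → ℂ}
    (hη : Integrable η) (hf : Integrable f) (x : EuclideanSpace ℝ (Fin n)) :
    ∫ ξ, Complex.exp (Complex.I * ((inner ℝ x ξ : ℝ) : ℂ)) * angularFourier f ξ * η ξ =
      conv (angularKernel η) f x := by
  simp_rw [exp_mul_angularFourier_mul]
  rw [integral_const_mul, integral_integral_swap (integrable_prod_phase hη hf x), conv,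
    convolution, ← integral_sub_left_eq_self _ volume x, ← integral_const_mul]
  refine integral_congr_ae (Filter.Eventually.of_forall fun y => ?_)
  simp only [ContinuousLinearMap.mul_apply', sub_sub_cancel, angularKernel]
  simp_rw [← mul_assoc]
  rw [integral_mul_const]
  ring

end Fubini

section Pieces

variable {n : ℕ} {ι : Type*} {Ω : Set (EuclideanSpace ℝ (Fin n))} {δ : ℝ}
  {m : EuclideanSpace ℝ (Fin n) → ℂ} {c : ι → EuclideanSpace ℝ (Fin n)} {r : ι → ℝ}
  {χ : ι → EuclideanSpace ℝ (Fin n) → ℝ}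

theorem whitneyPiece_eq_conv (hΩ : IsOpen Ω) (hm : IsBochnerRieszSymbol Ω δ m)
    (hO : IsWhitneyCovering Ω c r) (hχ : IsAdaptedPartition Ω c r χ) (j : ℤ)
    (hfin : {l | (2 : ℝ) ^ j ≤ r l ∧ r l < 2 * (2 : ℝ) ^ j}.Finite)
    {f : EuclideanSpace ℝ (Fin n) → ℂ} (hf : Integrable f) (x : EuclideanSpace ℝ (Fin n)) :
    whitneyPiece Ω δ m r χ j f x =
      conv (angularKernel fun ξ => ∑ l ∈ hfin.toFinset, localSymbol δ m χ ((2 : ℝ) ^ j) l ξ) f x := by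
  have hint : ∀ l, Integrable (localSymbol δ m χ ((2 : ℝ) ^ j) l) := fun l =>
    (contDiff_localSymbol hΩ hm hO hχ _ l).continuous.integrable_of_hasCompactSupport
      (hasCompactSupport_localSymbol hχ _ l)
  rw [← integral_exp_mul_angularFourier_mul (integrable_finsetSum _ fun l _ => hint l) hf x]
  simp_rw [Finset.mul_sum]
  rw [integral_finsetSum _ fun l _ => integrable_exp_mul_angularFourier_mul (hint l) hf x,
    whitneyPiece]
  have hset : {l | (2 : ℝ) ^ j ≤ r l ∧ r l < (2 : ℝ) ^ (j + 1)} =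
      {l | (2 : ℝ) ^ j ≤ r l ∧ r l < 2 * (2 : ℝ) ^ j} := by
    rw [zpow_add_one₀ two_ne_zero, mul_comm]
  rw [hset, finsum_mem_eq_finite_toFinset_sum _ hfin]
  refine Finset.sum_congr rfl fun l _ => ?_
  have hpow : (2 : ℝ) ^ (-((j : ℝ) * δ)) = ((2 : ℝ) ^ j) ^ (-δ) := by
    rw [← Real.rpow_intCast, ← Real.rpow_mul (by norm_num)]
    congr 1
    ring
  -- The restriction to Ω is harmless because χ_l vanishes off its ball, which lies in Ω.
  rw [setIntegral_eq_integral_of_forall_compl_eq_zero]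
  · refine integral_congr_ae (Filter.Eventually.of_forall fun ξ => ?_)
    simp only [localSymbol, hpow]
    ring
  · intro ξ hξ
    have : χ l ξ = 0 := by
      by_contra hne
      exact hξ (hO.ball_subset l (hχ.support_subset l hne))
    simp [this]

end Pieces

end

/-! ### Assembly at the scales t = 2^j -/

theorem proposition3p1 {n : ℕ} (hn : 1 ≤ n) {ι : Type*}
    (Ω : Set (EuclideanSpace ℝ (Fin n))) (hΩ : IsOpen Ω) (hΩb : Bornology.IsBounded Ω)
    (hΓ : IsLipschitzHypersurface (closure Ω \ Ω))
    (δ : ℝ) (hδ : 0 < δ) (m : EuclideanSpace ℝ (Fin n) → ℂ) (hm : IsBochnerRieszSymbol Ω δ m)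
    (c : ι → EuclideanSpace ℝ (Fin n)) (r : ι → ℝ) (hO : IsWhitneyCovering Ω c r)
    (χ : ι → EuclideanSpace ℝ (Fin n) → ℝ) (hχ : IsAdaptedPartition Ω c r χ) :
    ∃ K : ℤ → EuclideanSpace ℝ (Fin n) → ℂ,
      (∀ j, Integrable (K j)) ∧
      (∀ j f, Integrable f → ∀ x, whitneyPiece Ω δ m r χ j f x = conv (K j) f x) ∧
      (∃ C : ℝ, ∀ j : ℤ,
        ∫ x, ‖K j x‖ ≤ C * (2 : ℝ) ^ (-((j : ℝ) * (((n : ℝ) - 1) / 2))) ∧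
        ∀ p : ℝ≥0∞, 1 ≤ p →
          ConvBoundedOn (K j) p volume (C * (2 : ℝ) ^ (-((j : ℝ) * (((n : ℝ) - 1) / 2))))) ∧
      (∀ s : ℝ, 1 ≤ s → s ≤ 2 →
        (∃ C : ℝ, ∀ (j : ℤ) (f : EuclideanSpace ℝ (Fin n) → ℂ),
          AEStronglyMeasurable f volume → ∀ x,
            ‖conv (K j) f x‖ₑ ≤
              ENNReal.ofReal (C * (2 : ℝ) ^ (-((j : ℝ) * (((n : ℝ) - 1) / s)))) *
                maximalFunction s f x) ∧
        ∀ p : ℝ, s < p → ∀ w : EuclideanSpace ℝ (Fin n) → ℝ, IsMuckenhouptWeight (p / s) w →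
          ∃ C : ℝ, ∀ j : ℤ,
            ConvBoundedOn (K j) (ENNReal.ofReal p)
              (volume.withDensity fun x => ENNReal.ofReal (w x))
              (C * (2 : ℝ) ^ (-((j : ℝ) * (((n : ℝ) - 1) / s))))) := by
  have ht : ∀ j : ℤ, (0 : ℝ) < 2 ^ j := fun j => by positivity
  have hfin := fun j : ℤ => hO.finite_scale hn hΩb hΩ hΓ (ht j)
  have hI : ∀ j : ℤ, ∀ l ∈ (hfin j).toFinset, (2 : ℝ) ^ j ≤ r l ∧ r l < 2 * (2 : ℝ) ^ j :=
    fun j l hl => (hfin j).mem_toFinset.1 hl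
  set ψ : ℤ → EuclideanSpace ℝ (Fin n) → ℂ := fun j ξ =>
    ∑ l ∈ (hfin j).toFinset, localSymbol δ m χ ((2 : ℝ) ^ j) l ξ with hψ
  have hψs : ∀ j, ContDiff ℝ ∞ (ψ j) := fun j =>
    ContDiff.sum fun l _ => contDiff_localSymbol hΩ hm hO hχ _ l
  have hψc : ∀ j, HasCompactSupport (ψ j) := by
    intro j
    refine HasCompactSupport.of_support_subset_isCompact
      ((hfin j).toFinset.finite_toSet.isCompact_biUnion fun l _ => isCompact_closedBall (c l) (r l))
      fun ξ hξ => ?_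
    obtain ⟨l, hl, hne⟩ := Finset.exists_ne_zero_of_sum_ne_zero hξ
    exact Set.mem_biUnion hl (tsupport_localSymbol_subset hχ _ l (subset_closure hne))
  obtain ⟨B, V, hV, hBV⟩ := exists_sum_localSymbol_bounds hn hΩ hΩb hΓ hm hO hχ
  obtain ⟨C₁, -, hC₁⟩ := exists_angularKernel_bounds n
  obtain ⟨C₂, hC₂, hker⟩ := exists_lintegral_kernel_le n
  have hKm := fun j => aestronglyMeasurable_angularKernel (hψc j) (hψs j)
  set A : ℝ≥0∞ := ENNReal.ofReal (C₁ * B * V) with hA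
  -- B, V and hence A do not depend on j, so this single constant serves all scales and all s; the 1
  -- makes it positive.
  set C : ℝ := (C₂ * A).toReal + 1 with hC
  have hC0 : 0 < C := by positivity
  have hCA : C₂ * A ≤ ENNReal.ofReal C := by
    rw [ENNReal.le_ofReal_iff_toReal_le (ENNReal.mul_ne_top hC₂ ENNReal.ofReal_ne_top) hC0.le]
    linarith
  have hmain : ∀ s : ℝ, 1 ≤ s → s ≤ 2 → ∀ (j : ℤ) (f : EuclideanSpace ℝ (Fin n) → ℂ),
      AEStronglyMeasurable f volume → ∀ x,
      ∫⁻ y, ‖angularKernel (ψ j) y‖ₑ * ‖f (x - y)‖ₑ ≤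
        ENNReal.ofReal (C * (2 : ℝ) ^ (-((j : ℝ) * (((n : ℝ) - 1) / s)))) *
          maximalFunction s f x := by
    intro s hs1 hs2 j f hf x
    obtain ⟨h0, hN, hvol⟩ := hBV _ (ht j) _ (hI j)
    obtain ⟨hsup, hL2⟩ := hC₁ (ψ j) (hψc j) (hψs j) B _ V (ht j) hV h0 hN hvol
    refine (hker s hs1 hs2 A _ (ht j) _ (hKm j) hsup hL2 f hf x).trans ?_
    gcongr
    rw [ENNReal.ofReal_mul hC0.le, ENNReal.ofReal_rpow_of_pos (ht j), ← Real.rpow_intCast,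
      ← Real.rpow_mul (by norm_num), mul_neg]
    gcongr
  have hL1 : ∀ j : ℤ, ∫⁻ y, ‖angularKernel (ψ j) y‖ₑ ≤
      ENNReal.ofReal (C * (2 : ℝ) ^ (-((j : ℝ) * (((n : ℝ) - 1) / 2)))) := by
    intro j
    -- With f = 1 the left side is the L¹ norm of the kernel; s = 2 yields the exponent (n-1)/2.
    have h1 := hmain 2 one_le_two le_rfl j (fun _ => 1) aestronglyMeasurable_const 0
    simp only [enorm_one, mul_one] at h1
    exact h1.trans (mul_le_of_le_one_right' (maximalFunction_const_one_le two_pos _))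
  refine ⟨fun j => angularKernel (ψ j), fun j => ⟨hKm j, (hL1 j).trans_lt ENNReal.ofReal_lt_top⟩,
    fun j f hf x => whitneyPiece_eq_conv hΩ hm hO hχ j (hfin j) hf x, ⟨C, fun j => ⟨?_, ?_⟩⟩,
    fun s hs1 hs2 => ⟨⟨C, fun j f hf x => ?_⟩, fun p hsp w hw => ?_⟩⟩
  · rw [integral_norm_eq_lintegral_enorm (hKm j)]
    exact ENNReal.toReal_le_of_le_ofReal (by positivity) (hL1 j)
  · exact fun p hp => convBoundedOn_volume (hKm j) (hL1 j) hp
  · exact (enorm_conv_le _ f x).trans (hmain s hs1 hs2 j f hf x)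
  · obtain ⟨C', -, hC'⟩ := exists_convBoundedOn_withDensity (by linarith) hsp hw
    refine ⟨C' * C, fun j => ?_⟩
    rw [mul_assoc]
    exact hC' _ _ (hKm j) (hmain s hs1 hs2 j)
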